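/- **Definitions.** A graphon $H=(\Omega,\mathcal A,\pi,W)$ consists of a probability space $(\Omega,\mathcal A,\pi)$ and a bounded symmetric function $W:\Omega\times\Omega\to\mathbb R$ that is measurable with respect to the completion of $(\Omega\times\Omega,\mathcal A\times\mathcal A,\pi\times\pi)$. For a simple graph $F$ with $V(F)=\{1,\dots,k\}$ put $$t(F,H)=\int_{\Omega^k}\prod_{ij\in E(F)}W(x_i,x_j)\,\prod_{i=1}^k d\pi(x_i).$$ A measure preserving map $\phi:\Omega\to\Omega'$ between probability spaces is an isomorphism mod $0$ if there are measurable null sets $N\subset\Omega$, $N'\subset\Omega'$ such that $\phi$ restricts to a bijection $\Omega\setminus N\to\Omega'\setminus N'$ that is measure preserving in both directions. A Lebesgue space is a complete probability space that is isomorphic mod $0$ to the disjoint union of a closed interval (with the Lebesgue sets and Lebesgue measure; it may be degenerate) and a countable (possibly empty) set of atoms; a graphon on a Lebesgue space is called Lebesguian. Points $x_1,x_2\in\Omega$ are twins if $W(x_1,y)=W(x_2,y)$ for almost all $y\in\Omega$, and $H$ is almost twin-free if there is a null set $N$ such that no two distinct points of $\Omega\setminus N$ are twins. Graphons $H$ and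 $H'=(\Omega',\mathcal A',\pi',W')$ are isomorphic mod $0$, written $H\cong H'$, if there is an isomorphism mod $0$ $\phi:\Omega\to\Omega'$ with $W'(\phi(x),\phi(y))=W(x,y)$ for almost all $(x,y)\in\Omega\times\Omega$. A weak isomorphism from $H$ to a graphon $G=(\Gamma,\mathcal B,\rho,U)$ is a map $\phi:\Omega\to\Gamma$ that is measure preserving from the completion of $(\Omega,\mathcal A,\pi)$ into $(\Gamma,\mathcal B,\rho)$ and satisfies $W(x,y)=U(\phi(x),\phi(y))$ for almost all $(x,y)$. Two graphons are weakly isomorphic if both have weak isomorphisms into a common third graphon. A sequence $(G_n)$ of finite simple graphs with non-empty node sets converges to a graphon $H$ if $t(F,G_n)\to t(F,H)$ for every simple graph $F$, where $t(F,G_n)$ is the probability that a uniformly random map $V(F)\to V(G_n)$ preserves adjacency. **Theorem.** (i) If $H$ and $H'$ are almost twin-free Lebesguian graphons, then $t(F,H)=t(F,H')$ for every simple graph $F$ if and only if $H\cong H'$. (ii) If $H$ and $H'$ are arbitrary graphons, then $t(F,H)=t(F,H')$ for every simple graph $F$ if and only if $H$ and $H'$ are weakly isomorphic. In particular, the limit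 of a convergent graph sequence is unique up to measure preserving transformations: let $W,W':[0,1]^2\to[0,1]$ be symmetric Lebesgue measurable functions, and let $(G_n)$ be a sequence of finite simple graphs with non-empty node sets that converges to $W$ (as a graphon on $[0,1]$ with Lebesgue measure). Then $(G_n)$ converges to $W'$ as well if and only if there are a symmetric Lebesgue measurable function $U:[0,1]^2\to[0,1]$ and measure preserving maps $\varphi,\psi:[0,1]\to[0,1]$ such that $W(x,y)=U(\varphi(x),\varphi(y))$ and $W'(x,y)=U(\psi(x),\psi(y))$ for almost all $(x,y)\in[0,1]^2$. -/

import Mathlib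

open MeasureTheory
open scoped ENNReal

/-- A graphon on the probability space `(Ω, π)`: a bounded symmetric real function of two variables
that is measurable with respect to the completion of the product space. -/
structure Graphon (Ω : Type*) [MeasurableSpace Ω] (π : Measure Ω) [IsProbabilityMeasure π] where
  /-- The underlying two-variable function. -/
  W : Ω → Ω → ℝ
  symm : ∀ x y, W x y = W y x
  bounded : ∃ C : ℝ, ∀ x y, |W x y| ≤ C
  nullMeasurable : NullMeasurable (fun z : Ω × Ω => W z.1 z.2) (π.prod π)

/-- `φ` is an isomorphism mod 0: it is measure preserving, and off measurable null sets it restricts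
to a bijection that is measurable and measure preserving in both directions. -/
def IsIsoModZero {α β : Type*} [MeasurableSpace α] [MeasurableSpace β] (φ : α → β)
    (μ : Measure α) (ν : Measure β) : Prop :=
  MeasurePreserving φ μ ν ∧
    ∃ (N : Set α) (N' : Set β), MeasurableSet N ∧ μ N = 0 ∧ MeasurableSet N' ∧ ν N' = 0 ∧
      ∃ e : ↥(Nᶜ) ≃ᵐ ↥(N'ᶜ), (∀ x, (e x : β) = φ x) ∧
        MeasurePreserving e (μ.comap Subtype.val) (ν.comap Subtype.val)

/-- Lebesgue measure on `[a, b]` plus an atom of mass `p i` for each `i ∈ A`, on the Borel sets of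
the disjoint union of `[a, b]` and `A`. -/
noncomputable def intervalWithAtoms (a b : ℝ) (A : Set ℕ) (p : A → ℝ≥0∞) :
    Measure (Set.Icc a b ⊕ A) :=
  ((volume : Measure ℝ).comap (Subtype.val : Set.Icc a b → ℝ)).map Sum.inl +
    Measure.sum fun i : A => p i • Measure.dirac (Sum.inr i)

/-- A Lebesgue space: a complete space that is isomorphic mod 0 to the disjoint union of
a closed interval (with the Lebesgue sets and Lebesgue measure) and a countable set of atoms.
The Lebesgue sets appear through the completion of the Borel model. -/
def IsLebesgueSpace {Ω : Type*} [MeasurableSpace Ω] (π : Measure Ω) : Prop :=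
  π.IsComplete ∧
    ∃ (a b : ℝ) (A : Set ℕ) (p : A → ℝ≥0∞), a ≤ b ∧ (∀ i, p i ≠ 0) ∧
      ∃ φ : Ω → NullMeasurableSpace (Set.Icc a b ⊕ A) (intervalWithAtoms a b A p),
        IsIsoModZero φ π (intervalWithAtoms a b A p).completion

/-- The homomorphism density `t(F, G)` of a graph `F` in a graph `G` on `m` nodes: the probability
that a uniformly random map `V(F) → V(G)` preserves adjacency. -/
noncomputable def graphDensity {k m : ℕ} (F : SimpleGraph (Fin k)) (G : SimpleGraph (Fin m)) : ℝ :=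
  (Nat.card (F →g G) : ℝ) / (m : ℝ) ^ k

namespace Graphon

variable {Ω Ω' : Type*} [MeasurableSpace Ω] [MeasurableSpace Ω']
  {π : Measure Ω} [IsProbabilityMeasure π] {π' : Measure Ω'} [IsProbabilityMeasure π']

open scoped Classical in
/-- The homomorphism density `t(F, H) = ∫ ∏_{ij ∈ E(F)} W(x_i, x_j) dπ(x_1) ⋯ dπ(x_k)`. -/
noncomputable def density (H : Graphon Ω π) {k : ℕ} (F : SimpleGraph (Fin k)) : ℝ :=
  ∫ x : Fin k → Ω,
    ∏ e ∈ F.edgeFinset, Sym2.lift ⟨fun i j => H.W (x i) (x j), fun i j => H.symm (x i) (x j)⟩ e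
    ∂(Measure.pi fun _ => π)

/-- Two points are twins if their sections agree almost everywhere. -/
def Twins (H : Graphon Ω π) (x₁ x₂ : Ω) : Prop :=
  ∀ᵐ y ∂π, H.W x₁ y = H.W x₂ y

/-- Off some null set there are no two distinct twins. -/
def AlmostTwinFree (H : Graphon Ω π) : Prop :=
  ∃ N : Set Ω, π N = 0 ∧ ∀ x₁ ∉ N, ∀ x₂ ∉ N, x₁ ≠ x₂ → ¬ H.Twins x₁ x₂

/-- Isomorphism mod 0 of graphons. -/
def IsomorphicModZero (H : Graphon Ω π) (H' : Graphon Ω' π') : Prop :=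
  ∃ φ : Ω → Ω', IsIsoModZero φ π π' ∧
    ∀ᵐ z ∂π.prod π, H'.W (φ z.1) (φ z.2) = H.W z.1 z.2

/-- `φ` is a weak isomorphism from `H` to `G`: it is measure preserving from the completion of the
first space into the second, and `H` is almost everywhere the pull-back of `G`. -/
def IsWeakIso (H : Graphon Ω π) (G : Graphon Ω' π') (φ : Ω → Ω') : Prop :=
  MeasurePreserving (α := NullMeasurableSpace Ω π) φ π.completion π' ∧
    ∀ᵐ z ∂π.prod π, H.W z.1 z.2 = G.W (φ z.1) (φ z.2)

/-- All values of the graphon lie in `[0, 1]`. -/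
def UnitValued (H : Graphon Ω π) : Prop :=
  ∀ x y, H.W x y ∈ Set.Icc (0 : ℝ) 1

/-- The sequence of graphs `G n` (on `m n` nodes) converges to `H`. -/
def IsLimitOf (H : Graphon Ω π) {m : ℕ → ℕ} (G : ∀ n, SimpleGraph (Fin (m n))) : Prop :=
  ∀ (k : ℕ) (F : SimpleGraph (Fin k)),
    Filter.Tendsto (fun n => graphDensity F (G n)) Filter.atTop (nhds (H.density F))

end Graphon

universe u v w

/-- Two graphons are weakly isomorphic if both have weak isomorphisms into a third one. -/
def Graphon.WeaklyIsomorphic {Ω : Type u} {Ω' : Type v} [MeasurableSpace Ω] [MeasurableSpace Ω']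
    {π : Measure Ω} [IsProbabilityMeasure π] {π' : Measure Ω'} [IsProbabilityMeasure π']
    (H : Graphon Ω π) (H' : Graphon Ω' π') : Prop :=
  ∃ (Γ : Type w) (_ : MeasurableSpace Γ) (ρ : Measure Γ) (_ : IsProbabilityMeasure ρ)
    (G : Graphon Γ ρ) (φ : Ω → Γ) (ψ : Ω' → Γ), H.IsWeakIso G φ ∧ H'.IsWeakIso G ψ

/-!
A graphon is first replaced, up to weak isomorphism, by one on a standard Borel space whose kernel
is jointly measurable. For such an `H` choose independent random anchors `a₀, a₁, …` and send `x` to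
the sequence of the values at `(x, aⱼ)` of the self-convolution `∫ W(x, z) W(z, y) dz`. The
`L²` distance between the sections `W(x, ·)` and `W(y, ·)` is expressed by the self-convolution, so
almost surely this sequence determines the section of almost every point, and `W` factors through
it.

The conditional moments, given the anchors, of `W(x, y)` against products of the anchor values of
`x` and `y` have mixed moments which are themselves densities of simple graphs: a repeated edge can
occur only as a convolution edge, that is a path with its own middle vertex, and a product of
moments at the same anchors takes new vertices for each factor. Hence equality of all densities
gives the two families of conditional moments the same law. Both `H` and `H'` then almost surely
factor through the same kernel for a suitable choice of anchors, which is (ii). Two points with the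
same anchor values are almost surely twins, so for almost twin-free graphons the factor maps are
injective off a null set; on Lebesgue spaces they can therefore be inverted, which is (i). Over the
unit interval, the law of the anchor values may have atoms; spreading each of them over a copy of
`[0, 1]` makes it isomorphic to Lebesgue measure, while a map from an atomless space still lifts.
-/

section NullMeasurePreserving

variable {α β γ : Type*} [MeasurableSpace α] [MeasurableSpace β] [MeasurableSpace γ]
  {μ : Measure α} {ν : Measure β} {ξ : Measure γ}

/-- `φ` is measure preserving from the completion of `(α, μ)` to `(β, ν)`. This is
`MeasurePreserving` for the measurable structure `NullMeasurableSpace α μ`, phrased without changing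
the instance on `α`. -/
structure NullMeasurePreserving (φ : α → β) (μ : Measure α) (ν : Measure β) : Prop where
  nullMeasurable : NullMeasurable φ μ
  measure_preimage : ∀ s, MeasurableSet s → μ (φ ⁻¹' s) = ν s

theorem nullMeasurePreserving_iff {φ : α → β} :
    NullMeasurePreserving φ μ ν ↔
      MeasurePreserving (α := NullMeasurableSpace α μ) φ μ.completion ν where
  mp h := ⟨fun _ hs => h.nullMeasurable hs, by
    ext s hs
    rw [Measure.map_apply (fun _ ht => h.nullMeasurable ht) hs]
    exact h.measure_preimage s hs⟩
  mpr h := ⟨fun _ hs => h.measurable hs, fun _ hs => h.measure_preimage hs.nullMeasurableSet⟩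

namespace NullMeasurePreserving

theorem of_measurePreserving {φ : α → β} (h : MeasurePreserving φ μ ν) :
    NullMeasurePreserving φ μ ν :=
  ⟨h.measurable.nullMeasurable, fun _ hs => h.measure_preimage hs.nullMeasurableSet⟩

theorem ae {φ : α → β} (h : NullMeasurePreserving φ μ ν) {p : β → Prop} (hp : ∀ᵐ y ∂ν, p y) :
    ∀ᵐ x ∂μ, p (φ x) := by
  refine measure_mono_null (t := φ ⁻¹' toMeasurable ν {y | ¬ p y})
    (Set.preimage_mono (f := φ) (subset_toMeasurable ν {y | ¬ p y})) ?_
  rw [h.measure_preimage _ (measurableSet_toMeasurable _ _), measure_toMeasurable]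
  exact hp

theorem nullMeasurableSet_preimage {φ : α → β} (h : NullMeasurePreserving φ μ ν) {s : Set β}
    (hs : NullMeasurableSet s ν) : NullMeasurableSet (φ ⁻¹' s) μ := by
  obtain ⟨t, ht, hst⟩ := hs
  have hpre : φ ⁻¹' s =ᵐ[μ] φ ⁻¹' t := h.ae hst
  exact (h.nullMeasurable ht).congr hpre.symm

theorem measure_preimage₀ {φ : α → β} (h : NullMeasurePreserving φ μ ν) {s : Set β}
    (hs : NullMeasurableSet s ν) : μ (φ ⁻¹' s) = ν s := by
  obtain ⟨t, ht, hst⟩ := hs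
  have hpre : φ ⁻¹' s =ᵐ[μ] φ ⁻¹' t := h.ae hst
  rw [measure_congr hpre, h.measure_preimage t ht, ← measure_congr hst]

theorem comp {ψ : β → γ} {φ : α → β} (hψ : NullMeasurePreserving ψ ν ξ)
    (hφ : NullMeasurePreserving φ μ ν) : NullMeasurePreserving (ψ ∘ φ) μ ξ where
  nullMeasurable _ hs := hφ.nullMeasurableSet_preimage (hψ.nullMeasurable hs)
  measure_preimage s hs := by
    rw [Set.preimage_comp, hφ.measure_preimage₀ (hψ.nullMeasurable hs), hψ.measure_preimage s hs]

theorem congr {φ ψ : α → β} (h : NullMeasurePreserving φ μ ν) (he : φ =ᵐ[μ] ψ) :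
    NullMeasurePreserving ψ μ ν where
  nullMeasurable := h.nullMeasurable.congr he
  measure_preimage s hs := by
    rw [← h.measure_preimage s hs]
    refine measure_congr ?_
    filter_upwards [he] with x hx using congrArg (· ∈ s) hx.symm

theorem isProbabilityMeasure [IsProbabilityMeasure μ] {φ : α → β}
    (h : NullMeasurePreserving φ μ ν) : IsProbabilityMeasure ν :=
  ⟨by rw [← h.measure_preimage _ MeasurableSet.univ, Set.preimage_univ, measure_univ]⟩

theorem exists_measurePreserving [MeasurableSpace.CountablyGenerated β] {φ : α → β}
    (h : NullMeasurePreserving φ μ ν) : ∃ ψ : α → β, MeasurePreserving ψ μ ν ∧ φ =ᵐ[μ] ψ := by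
  have ha := h.nullMeasurable.aemeasurable
  refine ⟨ha.mk φ, ⟨ha.measurable_mk, ?_⟩, ha.ae_eq_mk⟩
  ext s hs
  rw [Measure.map_apply ha.measurable_mk hs]
  exact (h.congr ha.ae_eq_mk).measure_preimage s hs

theorem of_ae_leftInverse {φ : α → β} {ψ : β → α} (h : NullMeasurePreserving φ μ ν)
    (hψ : NullMeasurable ψ ν) (hinv : ∀ᵐ x ∂μ, ψ (φ x) = x) : NullMeasurePreserving ψ ν μ where
  nullMeasurable := hψ
  measure_preimage s hs := by
    rw [← h.measure_preimage₀ (hψ hs), ← Set.preimage_comp]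
    refine measure_congr ?_
    filter_upwards [hinv] with x hx using congrArg (· ∈ s) hx

theorem integral_comp {E : Type*} [NormedAddCommGroup E] [NormedSpace ℝ E] [MeasurableSpace E]
    [BorelSpace E] [SecondCountableTopology E] {φ : α → β} (h : NullMeasurePreserving φ μ ν)
    {f : β → E} (hf : AEMeasurable f ν) : ∫ x, f (φ x) ∂μ = ∫ y, f y ∂ν := by
  have hlaw : NullMeasurePreserving (hf.mk f) ν (ν.map (hf.mk f)) :=
    .of_measurePreserving ⟨hf.measurable_mk, rfl⟩
  obtain ⟨k, hk, hke⟩ := (hlaw.comp h).exists_measurePreserving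
  have hfk : ∀ᵐ x ∂μ, f (φ x) = k x := by
    filter_upwards [h.ae hf.ae_eq_mk, hke] with x hx hx' using hx.trans hx'
  calc ∫ x, f (φ x) ∂μ = ∫ x, k x ∂μ := integral_congr_ae hfk
    _ = ∫ t, t ∂(μ.map k) := (integral_map hk.measurable.aemeasurable
          measurable_id.aestronglyMeasurable).symm
    _ = ∫ t, t ∂(ν.map (hf.mk f)) := by rw [hk.map_eq]
    _ = ∫ y, hf.mk f y ∂ν := integral_map hf.measurable_mk.aemeasurable
          measurable_id.aestronglyMeasurable
    _ = ∫ y, f y ∂ν := integral_congr_ae hf.ae_eq_mk.symm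

theorem prodMap {α' β' : Type*} [MeasurableSpace α'] [MeasurableSpace β'] {μ' : Measure α'}
    {ν' : Measure β'} [SFinite μ'] [SigmaFinite ν] [SigmaFinite ν']
    {φ : α → β} {φ' : α' → β'} (h : NullMeasurePreserving φ μ ν)
    (h' : NullMeasurePreserving φ' μ' ν') :
    NullMeasurePreserving (Prod.map φ φ') (μ.prod μ') (ν.prod ν') := by
  have hm : Measurable (α := NullMeasurableSpace (α × α') (μ.prod μ')) (Prod.map φ φ') :=
    Measurable.prodMk
      (fun _ hs => (h.nullMeasurable hs).preimage Measure.quasiMeasurePreserving_fst)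
      (fun _ hs => (h'.nullMeasurable hs).preimage Measure.quasiMeasurePreserving_snd)
  refine nullMeasurePreserving_iff.2 ⟨hm, (Measure.prod_eq fun s t hs ht => ?_).symm⟩
  refine (Measure.map_apply hm (hs.prod ht)).trans ?_
  change (μ.prod μ') ((φ ⁻¹' s) ×ˢ (φ' ⁻¹' t)) = _
  rw [Measure.prod_prod, h.measure_preimage s hs, h'.measure_preimage t ht]

theorem piMap {ι : Type*} [Fintype ι] {α β : ι → Type*} [∀ i, MeasurableSpace (α i)]
    [∀ i, MeasurableSpace (β i)] {μ : ∀ i, Measure (α i)} {ν : ∀ i, Measure (β i)}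
    [∀ i, SigmaFinite (μ i)] [∀ i, SigmaFinite (ν i)] {φ : ∀ i, α i → β i}
    (h : ∀ i, NullMeasurePreserving (φ i) (μ i) (ν i)) :
    NullMeasurePreserving (fun x i => φ i (x i)) (Measure.pi μ) (Measure.pi ν) := by
  have hm : Measurable (α := NullMeasurableSpace (∀ i, α i) (Measure.pi μ))
      (fun x i => φ i (x i)) := measurable_pi_lambda _ fun i _ hs =>
    ((h i).nullMeasurable hs).preimage (Measure.quasiMeasurePreserving_eval μ i)
  refine nullMeasurePreserving_iff.2 ⟨hm, (Measure.pi_eq fun s hs => ?_).symm⟩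
  refine (Measure.map_apply hm (MeasurableSet.univ_pi hs)).trans ?_
  change (Measure.pi μ) (Set.univ.pi fun i => φ i ⁻¹' s i) = _
  rw [Measure.pi_pi]
  exact Finset.prod_congr rfl fun i _ => (h i).measure_preimage _ (hs i)

end NullMeasurePreserving

theorem measurePreserving_eval_pair {ι : Type*} [Fintype ι] {α : ι → Type*}
    [∀ i, MeasurableSpace (α i)] (μ : ∀ i, Measure (α i)) [∀ i, IsProbabilityMeasure (μ i)]
    {i j : ι} (hij : i ≠ j) :
    MeasurePreserving (fun x : ∀ i, α i => (x i, x j)) (Measure.pi μ) ((μ i).prod (μ j)) := by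
  refine ⟨by fun_prop, ?_⟩
  rw [← Measure.infinitePi_eq_pi, Measure.infinitePi_map_eval_prod hij]

end NullMeasurePreserving

section CountablyGenerated

variable {Ω E : Type*} [MeasurableSpace Ω] [MeasurableSpace E]

theorem exists_preimage_prodMap_eq_of_measurableSet {s : Set (Ω × Ω)} (hs : MeasurableSet s) :
    ∃ ψ : Ω → (ℕ → Prop), Measurable ψ ∧ ∃ t, MeasurableSet t ∧ Prod.map ψ ψ ⁻¹' t = s := by
  classical
  rw [← generateFrom_prod] at hs
  induction s, hs using MeasurableSpace.generateFrom_induction with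
  | hC s hs _ =>
    obtain ⟨a, ha, b, hb, rfl⟩ := hs
    refine ⟨fun x n => if n = 0 then x ∈ a else x ∈ b, measurable_pi_lambda _ fun n => ?_,
      {p | p.1 0} ∩ {p | p.2 1}, ?_, by ext ⟨x, y⟩; simp⟩
    · by_cases hn : n = 0
      · simpa [hn] using ha
      · simpa [hn] using hb
    · exact (measurableSet_setOfPred.2 ((measurable_pi_apply 0).comp measurable_fst)).inter
        (measurableSet_setOfPred.2 ((measurable_pi_apply 1).comp measurable_snd))
  | empty => exact ⟨fun _ _ => True, measurable_const, ∅, MeasurableSet.empty, rfl⟩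
  | compl s _ ih =>
    obtain ⟨ψ, hψ, t, ht, rfl⟩ := ih
    exact ⟨ψ, hψ, tᶜ, ht.compl, rfl⟩
  | iUnion s _ ih =>
    choose ψ hψ t ht h using ih
    have hrow (k : ℕ) : Measurable fun (u : ℕ → Prop) n => u (Nat.pair k n) :=
      measurable_pi_lambda _ fun n => measurable_pi_apply _
    refine ⟨fun x n => ψ n.unpair.1 x n.unpair.2, measurable_pi_lambda _ fun n =>
      (measurable_pi_apply _).comp (hψ _), _,
      MeasurableSet.iUnion fun k => ((hrow k).prodMap (hrow k)) (ht k), ?_⟩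
    rw [Set.preimage_iUnion]
    refine Set.iUnion_congr fun k => ?_
    rw [← h k]
    ext ⟨x, y⟩
    simp [Nat.unpair_pair]

theorem exists_eq_comp_prodMap_of_measurable [StandardBorelSpace E] [Nonempty E]
    {f : Ω × Ω → E} (hf : Measurable f) :
    ∃ (ψ : Ω → (ℕ → ℕ → Prop)) (g : (ℕ → ℕ → Prop) × (ℕ → ℕ → Prop) → E),
      Measurable ψ ∧ Measurable g ∧ f = g ∘ Prod.map ψ ψ := by
  choose ψ hψ t ht h using fun n => exists_preimage_prodMap_eq_of_measurableSet
    (hf (MeasurableSpace.measurableSet_natGeneratingSequence (α := E) n))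
  have hfψ : Measurable[MeasurableSpace.comap
      (Prod.map (fun x n => ψ n x) (fun x n => ψ n x)) inferInstance] f := by
    rw [← MeasurableSpace.generateFrom_natGeneratingSequence E]
    refine @measurable_generateFrom _ _ (_) _ _ ?_
    rintro _ ⟨n, rfl⟩
    exact ⟨Prod.map (fun u => u n) (fun u => u n) ⁻¹' t n,
      ((measurable_pi_apply n).prodMap (measurable_pi_apply n)) (ht n), h n⟩
  obtain ⟨g, hg, hfg⟩ := hfψ.exists_eq_measurable_comp
  exact ⟨_, g, measurable_pi_lambda _ hψ, hg, hfg⟩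

end CountablyGenerated

namespace Graphon

variable {Ω Ω' Ω'' : Type*} [MeasurableSpace Ω] [MeasurableSpace Ω'] [MeasurableSpace Ω'']
  {π : Measure Ω} [IsProbabilityMeasure π] {π' : Measure Ω'} [IsProbabilityMeasure π']
  {π'' : Measure Ω''} [IsProbabilityMeasure π'']

/-- A graphon is strong if its function is measurable with respect to the product of the two
σ-algebras, and not only with respect to the completion of the product. -/
def IsStrong (H : Graphon Ω π) : Prop :=
  Measurable fun z : Ω × Ω => H.W z.1 z.2

theorem isWeakIso_iff {H : Graphon Ω π} {G : Graphon Ω' π'} {φ : Ω → Ω'} :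
    H.IsWeakIso G φ ↔ NullMeasurePreserving φ π π' ∧
      ∀ᵐ z ∂π.prod π, H.W z.1 z.2 = G.W (φ z.1) (φ z.2) := by
  rw [nullMeasurePreserving_iff]; rfl

theorem IsWeakIso.comp {H : Graphon Ω π} {H' : Graphon Ω' π'} {H'' : Graphon Ω'' π''}
    {φ : Ω → Ω'} {ψ : Ω' → Ω''} (hψ : H'.IsWeakIso H'' ψ) (hφ : H.IsWeakIso H' φ) :
    H.IsWeakIso H'' (ψ ∘ φ) := by
  rw [isWeakIso_iff] at *
  refine ⟨hψ.1.comp hφ.1, ?_⟩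
  filter_upwards [hφ.2, (hφ.1.prodMap hφ.1).ae hψ.2] with z h1 h2 using h1.trans h2

theorem IsWeakIso.ae_eq_pi {H : Graphon Ω π} {G : Graphon Ω' π'} {φ : Ω → Ω'}
    (h : H.IsWeakIso G φ) (ι : Type*) [Fintype ι] :
    ∀ᵐ x ∂(Measure.pi fun _ : ι => π), ∀ i j, i ≠ j →
      H.W (x i) (x j) = G.W (φ (x i)) (φ (x j)) := by
  rw [ae_all_iff]; intro i
  rw [ae_all_iff]; intro j
  by_cases hij : i = j
  · simp [hij]
  · filter_upwards [(measurePreserving_eval_pair (fun _ => π) hij).quasiMeasurePreserving.ae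
      (isWeakIso_iff.1 h).2] with x hx _ using hx

theorem IsWeakIso.density_eq {H : Graphon Ω π} {G : Graphon Ω' π'} {φ : Ω → Ω'}
    (h : H.IsWeakIso G φ) {k : ℕ} (F : SimpleGraph (Fin k)) : H.density F = G.density F := by
  classical
  unfold density
  rw [← (NullMeasurePreserving.piMap fun _ : Fin k => (isWeakIso_iff.1 h).1).integral_comp]
  · refine integral_congr_ae ?_
    filter_upwards [h.ae_eq_pi (Fin k)] with x hx
    refine Finset.prod_congr rfl fun e he => ?_
    induction e with
    | _ i j =>
      rw [SimpleGraph.mem_edgeFinset, SimpleGraph.mem_edgeSet] at he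
      exact hx i j he.ne
  · refine Finset.aemeasurable_fun_prod _ fun e he => ?_
    induction e with
    | _ i j =>
      rw [SimpleGraph.mem_edgeFinset, SimpleGraph.mem_edgeSet] at he
      exact G.nullMeasurable.aemeasurable.comp_quasiMeasurePreserving
        (measurePreserving_eval_pair (fun _ => π') he.ne).quasiMeasurePreserving

/-- The graphon of a measurable kernel `g`, which need not be symmetric or bounded: `g` is replaced
by its symmetric part, clamped to the interval `[a, b]`. -/
noncomputable def ofKernel (π : Measure Ω) [IsProbabilityMeasure π] {g : Ω × Ω → ℝ}
    (hg : Measurable g) {a b : ℝ} (hab : a ≤ b) : Graphon Ω π where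
  W x y := Set.projIcc a b hab ((g (x, y) + g (y, x)) / 2)
  symm x y := by rw [add_comm]
  bounded := ⟨max |a| |b|, fun _ _ => abs_le_max_abs_abs (Set.projIcc a b hab _).2.1
    (Set.projIcc a b hab _).2.2⟩
  nullMeasurable := by
    have : Measurable fun z : Ω × Ω => (g (z.1, z.2) + g (z.2, z.1)) / 2 := by fun_prop
    exact (measurable_subtype_coe.comp
      (continuous_projIcc.measurable.comp this)).nullMeasurable

section OfKernel

variable {g : Ω' × Ω' → ℝ} {hg : Measurable g} {a b : ℝ} {hab : a ≤ b}

theorem ofKernel_mem_Icc (x y : Ω') : (ofKernel π' hg hab).W x y ∈ Set.Icc a b :=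
  Subtype.coe_prop _

theorem isStrong_ofKernel : (ofKernel π' hg hab).IsStrong := by
  have : Measurable fun z : Ω' × Ω' => (g (z.1, z.2) + g (z.2, z.1)) / 2 := by fun_prop
  exact measurable_subtype_coe.comp (continuous_projIcc.measurable.comp this)

theorem ofKernel_apply_of_swap_eq {x y : Ω'} (hswap : g (y, x) = g (x, y))
    (hmem : g (x, y) ∈ Set.Icc a b) : (ofKernel π' hg hab).W x y = g (x, y) := by
  change ((Set.projIcc a b hab ((g (x, y) + g (y, x)) / 2) : Set.Icc a b) : ℝ) = _
  rw [hswap, add_self_div_two, Set.projIcc_of_mem hab hmem]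

variable {H : Graphon Ω π} {ψ : Ω → Ω'}

theorem ofKernel_ae_eq (hψ : NullMeasurePreserving ψ π π')
    (h : ∀ᵐ z ∂π.prod π, H.W z.1 z.2 = g (ψ z.1, ψ z.2))
    (hH : ∀ x y, H.W x y ∈ Set.Icc a b) :
    ∀ᵐ z ∂π'.prod π', (ofKernel π' hg hab).W z.1 z.2 = g z := by
  have hswap : ∀ᵐ z ∂π.prod π, H.W z.2 z.1 = g (ψ z.2, ψ z.1) :=
    (Measure.measurePreserving_swap (μ := π) (ν := π)).quasiMeasurePreserving.ae h
  have hpull : ∀ᵐ z ∂π.prod π,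
      (ofKernel π' hg hab).W (ψ z.1) (ψ z.2) = g (ψ z.1, ψ z.2) := by
    filter_upwards [h, hswap] with z h1 h2
    exact ofKernel_apply_of_swap_eq (by rw [← h1, ← h2, H.symm]) (h1 ▸ hH _ _)
  have hmeas : MeasurableSet {z : Ω' × Ω' | (ofKernel π' hg hab).W z.1 z.2 = g z} :=
    measurableSet_eq_fun isStrong_ofKernel hg
  exact ((hψ.prodMap hψ).measure_preimage _ hmeas.compl).symm.trans hpull

theorem isWeakIso_ofKernel (hψ : NullMeasurePreserving ψ π π')
    (h : ∀ᵐ z ∂π.prod π, H.W z.1 z.2 = g (ψ z.1, ψ z.2))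
    (hH : ∀ x y, H.W x y ∈ Set.Icc a b) : H.IsWeakIso (ofKernel π' hg hab) ψ := by
  refine isWeakIso_iff.2 ⟨hψ, ?_⟩
  filter_upwards [h, (hψ.prodMap hψ).ae (ofKernel_ae_eq (hab := hab) hψ h hH)] with z h1 h2
  rw [h1]
  exact h2.symm

end OfKernel

theorem exists_forall_mem_Icc (H : Graphon Ω π) :
    ∃ a b : ℝ, a ≤ b ∧ ∀ x y, H.W x y ∈ Set.Icc a b := by
  obtain ⟨C, hC⟩ := H.bounded
  obtain ⟨x⟩ := nonempty_of_isProbabilityMeasure π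
  exact ⟨-C, C, neg_le_self ((abs_nonneg _).trans (hC x x)), fun x y => abs_le.1 (hC x y)⟩

theorem exists_isWeakIso_standardBorel (H : Graphon Ω π) :
    ∃ (ρ : Measure (ℕ → ℕ → Prop)) (_ : IsProbabilityMeasure ρ) (G : Graphon (ℕ → ℕ → Prop) ρ)
      (ψ : Ω → (ℕ → ℕ → Prop)), G.IsStrong ∧ H.IsWeakIso G ψ := by
  have ha := H.nullMeasurable.aemeasurable
  obtain ⟨ψ, g, hψ, hg, hfg⟩ := exists_eq_comp_prodMap_of_measurable ha.measurable_mk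
  obtain ⟨a, b, hab, hH⟩ := H.exists_forall_mem_Icc
  have hρ := Measure.isProbabilityMeasure_map (μ := π) hψ.aemeasurable
  refine ⟨π.map ψ, hρ, ofKernel (π.map ψ) hg hab, ψ, isStrong_ofKernel, isWeakIso_ofKernel
    (.of_measurePreserving ⟨hψ, rfl⟩) ?_ hH⟩
  filter_upwards [ha.ae_eq_mk] with z hz
  rw [hz, hfg]
  rfl

end Graphon

section BddMeasurable

variable {α β ι : Type*} [MeasurableSpace α] [MeasurableSpace β]

/-- Bounded measurable real functions. They are integrable for every finite measure and closed under
the products and partial integrals that occur in subgraph densities. -/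
structure BddMeasurable (f : α → ℝ) : Prop where
  measurable : Measurable f
  bounded : ∃ C : ℝ, ∀ x, |f x| ≤ C

namespace BddMeasurable

theorem const (c : ℝ) : BddMeasurable fun _ : α => c := ⟨measurable_const, |c|, fun _ => le_rfl⟩

theorem mul {f g : α → ℝ} (hf : BddMeasurable f) (hg : BddMeasurable g) :
    BddMeasurable fun x => f x * g x := by
  obtain ⟨C, hC⟩ := hf.bounded
  obtain ⟨D, hD⟩ := hg.bounded
  refine ⟨hf.measurable.mul hg.measurable, C * D, fun x => ?_⟩
  rw [abs_mul]
  exact mul_le_mul (hC x) (hD x) (abs_nonneg _) ((abs_nonneg _).trans (hC x))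

theorem sub {f g : α → ℝ} (hf : BddMeasurable f) (hg : BddMeasurable g) :
    BddMeasurable fun x => f x - g x := by
  obtain ⟨C, hC⟩ := hf.bounded
  obtain ⟨D, hD⟩ := hg.bounded
  exact ⟨hf.measurable.sub hg.measurable, C + D, fun x =>
    (abs_sub _ _).trans (add_le_add (hC x) (hD x))⟩

theorem comp {f : β → ℝ} (hf : BddMeasurable f) {g : α → β} (hg : Measurable g) :
    BddMeasurable fun x => f (g x) :=
  ⟨hf.measurable.comp hg, hf.bounded.imp fun _ h x => h (g x)⟩

theorem list_prod {f : ι → α → ℝ} (hf : ∀ i, BddMeasurable (f i)) (l : List ι) :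
    BddMeasurable fun x => (l.map fun i => f i x).prod := by
  induction l with
  | nil => simpa using const 1
  | cons i l ih => simpa using (hf i).mul ih

theorem finset_prod {f : ι → α → ℝ} (hf : ∀ i, BddMeasurable (f i)) (s : Finset ι) :
    BddMeasurable fun x => ∏ i ∈ s, f i x := by
  simpa using list_prod hf s.toList

theorem integrable {f : α → ℝ} (hf : BddMeasurable f) (μ : Measure α) [IsFiniteMeasure μ] :
    Integrable f μ := by
  obtain ⟨C, hC⟩ := hf.bounded
  exact .of_bound hf.measurable.aestronglyMeasurable C (.of_forall hC)

theorem integral_right {f : α × β → ℝ} (hf : BddMeasurable f) (ν : Measure β)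
    [IsProbabilityMeasure ν] : BddMeasurable fun x => ∫ y, f (x, y) ∂ν := by
  obtain ⟨C, hC⟩ := hf.bounded
  refine ⟨(hf.measurable.stronglyMeasurable.integral_prod_right').measurable, C, fun x => ?_⟩
  simpa using norm_integral_le_of_norm_le_const (μ := ν) (f := fun y => f (x, y)) (C := C)
    (.of_forall fun y => hC (x, y))

end BddMeasurable

theorem integral_pi_fin_succ {Ω : Type*} [MeasurableSpace Ω] (π : Measure Ω)
    [IsProbabilityMeasure π] {n : ℕ} {f : (Fin (n + 1) → Ω) → ℝ} (hf : BddMeasurable f) :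
    ∫ x, f x ∂(Measure.pi fun _ => π) =
      ∫ x : Fin n → Ω, ∫ z, f (Fin.cons z x) ∂π ∂(Measure.pi fun _ => π) := by
  have h := (measurePreserving_piFinSuccAbove (fun _ : Fin (n + 1) => π) 0).symm
  have e (z : Ω × (Fin n → Ω)) : (MeasurableEquiv.piFinSuccAbove (fun _ => Ω) 0).symm z =
      (Fin.cons z.1 z.2 : Fin (n + 1) → Ω) := by
    rw [MeasurableEquiv.piFinSuccAbove_symm_apply]
    exact Fin.insertNth_zero' z.1 z.2
  rw [← h.integral_comp' f, integral_prod_symm]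
  · simp only [e]
  · exact (hf.comp (MeasurableEquiv.measurable _)).integrable _

end BddMeasurable

namespace Graphon

variable {Ω : Type*} [MeasurableSpace Ω] {π : Measure Ω} [IsProbabilityMeasure π]

/-- The convolution square `∫ W(x, z) W(z, y) dπ(z)`, the density of the paths of length two from
`x` to `y`. -/
noncomputable def conv (H : Graphon Ω π) (x y : Ω) : ℝ := ∫ z, H.W x z * H.W z y ∂π

/-- The product of the values `conv(z, a_j)` over the anchors `a_j` listed in `l`. -/
noncomputable def convProd (H : Graphon Ω π) {ι : Type*} (a : ι → Ω) (l : List ι) (z : Ω) : ℝ :=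
  (l.map fun j => H.conv z (a j)).prod

theorem convProd_map (H : Graphon Ω π) {ι κ : Type*} (a : κ → Ω) (c : ι → κ) (l : List ι) (z : Ω) :
    H.convProd a (l.map c) z = H.convProd (a ∘ c) l z := by
  simp [convProd, Function.comp_def]

theorem convProd_congr (H : Graphon Ω π) {ι : Type*} {a b : ι → Ω} {l : List ι}
    (h : ∀ j ∈ l, a j = b j) (z : Ω) : H.convProd a l z = H.convProd b l z :=
  congrArg List.prod (List.map_congr_left fun j hj => by rw [h j hj])

section IsStrong

variable {H : Graphon Ω π} {α ι : Type*} [MeasurableSpace α]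

theorem IsStrong.bddMeasurable_W (hH : H.IsStrong) {f g : α → Ω} (hf : Measurable f)
    (hg : Measurable g) : BddMeasurable fun p => H.W (f p) (g p) :=
  BddMeasurable.comp (f := fun z : Ω × Ω => H.W z.1 z.2)
    ⟨hH, H.bounded.imp fun _ h z => h z.1 z.2⟩ (hf.prodMk hg)

theorem IsStrong.bddMeasurable_conv (hH : H.IsStrong) {f g : α → Ω} (hf : Measurable f)
    (hg : Measurable g) : BddMeasurable fun p => H.conv (f p) (g p) :=
  BddMeasurable.integral_right (f := fun p : α × Ω => H.W (f p.1) p.2 * H.W p.2 (g p.1))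
    ((hH.bddMeasurable_W (by fun_prop) (by fun_prop)).mul
      (hH.bddMeasurable_W (by fun_prop) (by fun_prop))) π

theorem IsStrong.bddMeasurable_convProd (hH : H.IsStrong) {a : ι → α → Ω}
    (ha : ∀ j, Measurable (a j)) {f : α → Ω} (hf : Measurable f) (l : List ι) :
    BddMeasurable fun p => H.convProd (fun j => a j p) l (f p) :=
  BddMeasurable.list_prod (fun j => hH.bddMeasurable_conv hf (ha j)) l

end IsStrong

/-- The value of `W` on an unordered pair of indices. -/
def edgeValue (H : Graphon Ω π) {V : Type*} (x : V → Ω) (e : Sym2 V) : ℝ :=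
  Sym2.lift ⟨fun i j => H.W (x i) (x j), fun i j => H.symm (x i) (x j)⟩ e

theorem edgeValue_mk (H : Graphon Ω π) {V : Type*} (x : V → Ω) (i j : V) :
    H.edgeValue x s(i, j) = H.W (x i) (x j) := rfl

theorem edgeValue_map (H : Graphon Ω π) {V V' : Type*} (f : V → V') (x : V' → Ω) (e : Sym2 V) :
    H.edgeValue x (e.map f) = H.edgeValue (x ∘ f) e := by
  induction e with | _ i j => rfl

end Graphon

/-- The index of an anchored moment: whether the factor `W` occurs, and the two lists of anchors. -/
abbrev MomentIndex (ι : Type*) := Bool × List ι × List ι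

/-- A loopless graph on `Fin n` with two kinds of edges: simple edges, which stand for `W`, and
convolution edges, which may be multiple and stand for the convolution square of `W`. -/
structure DecoratedGraph (n : ℕ) where
  edges : Finset (Sym2 (Fin n))
  not_isDiag : ∀ e ∈ edges, ¬ e.IsDiag
  convEdges : List (Fin n × Fin n)
  fst_ne_snd : ∀ p ∈ convEdges, p.1 ≠ p.2

namespace DecoratedGraph

variable {n : ℕ}

/-- Add a new vertex `0`, joined by a simple edge to each vertex in `S` and by a convolution edge to
each entry of `l`; the old vertices are shifted by one. -/
def adjoin (D : DecoratedGraph n) (S : Finset (Fin n)) (l : List (Fin n)) :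
    DecoratedGraph (n + 1) where
  edges := S.image (fun i => s(0, i.succ)) ∪ D.edges.image (Sym2.map Fin.succ)
  not_isDiag e he := by
    rcases Finset.mem_union.1 he with he | he
    · obtain ⟨i, -, rfl⟩ := Finset.mem_image.1 he
      simpa using (Fin.succ_ne_zero i).symm
    · obtain ⟨e, he', rfl⟩ := Finset.mem_image.1 he
      rw [Sym2.isDiag_map (Fin.succ_injective n)]
      exact D.not_isDiag e he'
  convEdges := l.map (fun i => (0, i.succ)) ++ D.convEdges.map (Prod.map Fin.succ Fin.succ)
  fst_ne_snd p hp := by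
    rcases List.mem_append.1 hp with hp | hp
    · obtain ⟨i, -, rfl⟩ := List.mem_map.1 hp
      exact (Fin.succ_ne_zero i).symm
    · obtain ⟨q, hq, rfl⟩ := List.mem_map.1 hp
      simpa using D.fst_ne_snd q hq

theorem disjoint_adjoin_edges (E : Finset (Sym2 (Fin n))) (S : Finset (Fin n)) :
    Disjoint (S.image fun i => s(0, i.succ)) (E.image (Sym2.map Fin.succ)) := by
  rw [Finset.disjoint_left]
  intro e h1 h2
  obtain ⟨i, -, rfl⟩ := Finset.mem_image.1 h1
  obtain ⟨e, -, he⟩ := Finset.mem_image.1 h2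
  induction e with
  | _ a b => simp [Fin.succ_ne_zero] at he

/-- The decorated graph obtained by adjoining one vertex for each of the two integration variables
of the moment `t`, where the `j`-th anchor is the vertex `c j`. -/
def adjoinMoment {ι : Type*} (D : DecoratedGraph n) (c : ι → Fin n)
    (t : MomentIndex ι) : DecoratedGraph (n + 2) :=
  (D.adjoin ∅ (t.2.2.map c)).adjoin (if t.1 then {0} else ∅) (t.2.1.map (Fin.succ ∘ c))

end DecoratedGraph

namespace Graphon

variable {Ω : Type*} [MeasurableSpace Ω] {π : Measure Ω} [IsProbabilityMeasure π] {n : ℕ}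

/-- The integrand of the density of a decorated graph: the product of `W` over the simple edges and
of the convolution square over the convolution edges. -/
noncomputable def weight (H : Graphon Ω π) (D : DecoratedGraph n) (x : Fin n → Ω) : ℝ :=
  (∏ e ∈ D.edges, H.edgeValue x e) * (D.convEdges.map fun p => H.conv (x p.1) (x p.2)).prod

/-- The factor by which the weight of a decorated graph changes when a new vertex, placed at `z`, is
adjoined. -/
noncomputable def vertexWeight (H : Graphon Ω π) (S : Finset (Fin n)) (l : List (Fin n))
    (x : Fin n → Ω) (z : Ω) : ℝ :=
  (∏ i ∈ S, H.W z (x i)) * H.convProd x l z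

theorem IsStrong.bddMeasurable_weight {H : Graphon Ω π} (hH : H.IsStrong) (D : DecoratedGraph n) :
    BddMeasurable (H.weight D) := by
  refine BddMeasurable.mul (BddMeasurable.finset_prod (fun e => ?_) _)
    (BddMeasurable.list_prod (f := fun (p : Fin n × Fin n) (x : Fin n → Ω) =>
      H.conv (x p.1) (x p.2)) (fun p => hH.bddMeasurable_conv (by fun_prop) (by fun_prop)) _)
  induction e with
  | _ i j => exact hH.bddMeasurable_W (by fun_prop) (by fun_prop)

theorem weight_adjoin (H : Graphon Ω π) (D : DecoratedGraph n) (S : Finset (Fin n))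
    (l : List (Fin n)) (z : Ω) (x : Fin n → Ω) :
    H.weight (D.adjoin S l) (Fin.cons z x) = H.weight D x * H.vertexWeight S l x z := by
  have hx : (Fin.cons z x : Fin (n + 1) → Ω) ∘ Fin.succ = x := by ext k; simp
  have hedges : ∏ e ∈ (D.adjoin S l).edges, H.edgeValue (Fin.cons z x) e =
      (∏ i ∈ S, H.W z (x i)) * ∏ e ∈ D.edges, H.edgeValue x e := by
    rw [DecoratedGraph.adjoin, Finset.prod_union (DecoratedGraph.disjoint_adjoin_edges _ _),
      Finset.prod_image fun i _ j _ h => by simpa using h,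
      Finset.prod_image fun a _ b _ h => Sym2.map.injective (Fin.succ_injective n) h]
    simp only [edgeValue_map, hx, edgeValue_mk, Fin.cons_zero, Fin.cons_succ]
  rw [weight, hedges, weight, vertexWeight, convProd]
  simp only [DecoratedGraph.adjoin, List.map_append, List.prod_append, List.map_map,
    Function.comp_def, Prod.map_fst, Prod.map_snd, Fin.cons_zero, Fin.cons_succ]
  ring

theorem IsStrong.integral_weight_adjoin_mul {H : Graphon Ω π} (hH : H.IsStrong)
    (D : DecoratedGraph n) (S : Finset (Fin n)) (l : List (Fin n)) {f : (Fin (n + 1) → Ω) → ℝ}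
    (hf : BddMeasurable f) :
    ∫ x, H.weight (D.adjoin S l) x * f x ∂(Measure.pi fun _ => π) =
      ∫ x, H.weight D x * ∫ z, H.vertexWeight S l x z * f (Fin.cons z x) ∂π
        ∂(Measure.pi fun _ => π) := by
  rw [integral_pi_fin_succ π ((hH.bddMeasurable_weight _).mul hf)]
  simp only [weight_adjoin, mul_assoc, integral_const_mul]

theorem density_fromEdgeSet (H : Graphon Ω π) (D : DecoratedGraph n) (hD : D.convEdges = []) :
    H.density (SimpleGraph.fromEdgeSet (D.edges : Set (Sym2 (Fin n)))) =
      ∫ x, H.weight D x ∂(Measure.pi fun _ => π) := by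
  classical
  have hedges : (SimpleGraph.fromEdgeSet (D.edges : Set (Sym2 (Fin n)))).edgeFinset = D.edges := by
    ext e
    simpa using D.not_isDiag e
  simp only [density, weight, hD, List.map_nil, List.prod_nil, mul_one, edgeValue]
  congr! 3
  convert! hedges

theorem IsStrong.integral_weight_of_convEdges_eq_cons {H : Graphon Ω π} (hH : H.IsStrong)
    {D D₀ : DecoratedGraph n} {i j : Fin n} (hij : i ≠ j) (hedges : D₀.edges = D.edges)
    (hconv : D.convEdges = (i, j) :: D₀.convEdges) :
    ∫ x, H.weight D x ∂(Measure.pi fun _ => π) =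
      ∫ x, H.weight (D₀.adjoin {i, j} []) x ∂(Measure.pi fun _ => π) := by
  have h := hH.integral_weight_adjoin_mul D₀ {i, j} [] (.const 1)
  simp only [mul_one] at h
  rw [h]
  congr! 2 with x
  simp only [weight, vertexWeight, convProd, conv, hedges, hconv, Finset.prod_pair hij,
    H.symm _ (x i), List.map_cons, List.map_nil, List.prod_cons, List.prod_nil, mul_one]
  ring

/-- The anchored moment `∫ W(z, w)^ε ∏_j conv(z, a_j) ∏_k conv(w, a_k)` over `(z, w)`, where
`ε ∈ {0, 1}` and the lists of indices `j`, `k` are given by `t`. -/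
noncomputable def moment (H : Graphon Ω π) {ι : Type*} (t : MomentIndex ι) (a : ι → Ω) : ℝ :=
  ∫ p : Ω × Ω, (if t.1 then H.W p.1 p.2 else 1) *
    (H.convProd a t.2.1 p.1 * H.convProd a t.2.2 p.2) ∂(π.prod π)

section moment

variable {H : Graphon Ω π} {α ι : Type*} [MeasurableSpace α]

theorem moment_congr (t : MomentIndex ι) {a b : ι → Ω} (h : ∀ j ∈ t.2.1 ++ t.2.2, a j = b j) :
    H.moment t a = H.moment t b := by
  have h1 := H.convProd_congr fun j hj => h j (List.mem_append_left _ hj)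
  have h2 := H.convProd_congr fun j hj => h j (List.mem_append_right _ hj)
  simp only [moment, h1, h2]

theorem IsStrong.bddMeasurable_momentIntegrand (hH : H.IsStrong) (t : MomentIndex ι)
    {a : ι → α → Ω} (ha : ∀ j, Measurable (a j)) {f g : α → Ω} (hf : Measurable f)
    (hg : Measurable g) :
    BddMeasurable fun p => (if t.1 then H.W (f p) (g p) else 1) *
      (H.convProd (fun j => a j p) t.2.1 (f p) * H.convProd (fun j => a j p) t.2.2 (g p)) := by
  refine .mul ?_ ((hH.bddMeasurable_convProd ha hf _).mul (hH.bddMeasurable_convProd ha hg _))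
  split_ifs
  exacts [hH.bddMeasurable_W hf hg, .const 1]

theorem IsStrong.bddMeasurable_moment (hH : H.IsStrong) (t : MomentIndex ι) :
    BddMeasurable (H.moment t) :=
  (hH.bddMeasurable_momentIntegrand (α := (ι → Ω) × (Ω × Ω)) t (a := fun j p => p.1 j)
    (f := fun p => p.2.1) (g := fun p => p.2.2) (by fun_prop) (by fun_prop)
    (by fun_prop)).integral_right _

theorem IsStrong.bddMeasurable_prod_moment (hH : H.IsStrong) (T : List (MomentIndex ι)) :
    BddMeasurable fun a => (T.map fun t => H.moment t a).prod :=
  .list_prod (fun t => hH.bddMeasurable_moment t) T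

theorem IsStrong.moment_eq_integral_integral (hH : H.IsStrong) (t : MomentIndex ι) (a : ι → Ω) :
    H.moment t a = ∫ w, ∫ z, (if t.1 then H.W z w else 1) *
      (H.convProd a t.2.1 z * H.convProd a t.2.2 w) ∂π ∂π :=
  integral_prod_symm _ ((hH.bddMeasurable_momentIntegrand t (a := fun j (_ : Ω × Ω) => a j)
    (by fun_prop) measurable_fst measurable_snd).integrable _)

theorem IsStrong.bddMeasurable_vertexWeight (hH : H.IsStrong) (S : Finset (Fin n))
    (l : List (Fin n)) :
    BddMeasurable fun p : (Fin n → Ω) × Ω => H.vertexWeight S l p.1 p.2 :=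
  .mul (.finset_prod (fun i => hH.bddMeasurable_W measurable_snd (by fun_prop)) S)
    (hH.bddMeasurable_convProd (α := (Fin n → Ω) × Ω) (a := fun i p => p.1 i)
      (by fun_prop) measurable_snd l)

end moment

theorem IsStrong.integral_weight_mul_moment_mul {ι : Type*} {H : Graphon Ω π} (hH : H.IsStrong)
    (D : DecoratedGraph n) (c : ι → Fin n) (t : MomentIndex ι) {P : (ι → Ω) → ℝ}
    (hP : BddMeasurable P) :
    ∫ x, H.weight D x * (H.moment t (x ∘ c) * P (x ∘ c)) ∂(Measure.pi fun _ => π) =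
      ∫ x, H.weight (D.adjoinMoment c t) x * P (x ∘ Fin.succ ∘ Fin.succ ∘ c)
        ∂(Measure.pi fun _ => π) := by
  have hP' : BddMeasurable fun x : Fin (n + 2) → Ω => P (x ∘ Fin.succ ∘ Fin.succ ∘ c) :=
    hP.comp (measurable_pi_lambda _ fun j => measurable_pi_apply _)
  have hcons : Measurable fun p : (Fin (n + 1) → Ω) × Ω => (Fin.cons p.2 p.1 : Fin (n + 2) → Ω) :=
    measurable_pi_lambda _ (Fin.cases measurable_snd fun i =>
      (measurable_pi_apply i).comp measurable_fst)
  rw [DecoratedGraph.adjoinMoment, hH.integral_weight_adjoin_mul _ _ _ hP',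
    hH.integral_weight_adjoin_mul D ∅ _
      (((hH.bddMeasurable_vertexWeight _ _).mul (hP'.comp hcons)).integral_right π)]
  congr! 3 with x
  have hx (z w : Ω) : (Fin.cons z (Fin.cons w x) : Fin (n + 2) → Ω) ∘ Fin.succ ∘ Fin.succ ∘ c =
      x ∘ c := rfl
  have hW (w z : Ω) : ∏ i ∈ (if t.1 then {0} else ∅ : Finset (Fin (n + 1))),
      H.W z ((Fin.cons w x : Fin (n + 1) → Ω) i) = if t.1 then H.W z w else 1 := by
    split_ifs <;> simp
  have hl (w : Ω) : (Fin.cons w x : Fin (n + 1) → Ω) ∘ Fin.succ ∘ c = x ∘ c := rfl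
  simp only [hH.moment_eq_integral_integral, hx, vertexWeight, hW, convProd_map, hl,
    Finset.prod_empty, one_mul, ← integral_mul_const, ← integral_const_mul]
  congr! 4
  ring

theorem IsStrong.integral_prod_moment_infinitePi {H : Graphon Ω π} (hH : H.IsStrong)
    (T : List (MomentIndex ℕ)) {N : ℕ} (hN : ∀ t ∈ T, ∀ j ∈ t.2.1 ++ t.2.2, j ≤ N) :
    ∫ a, (T.map fun t => H.moment t a).prod ∂(Measure.infinitePi fun _ : ℕ => π) =
      ∫ x : Fin (N + 1) → Ω, (T.map fun t => H.moment t (x ∘ Fin.ofNat (N + 1))).prod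
        ∂(Measure.pi fun _ => π) := by
  have hpi : (Measure.infinitePi fun _ : ℕ => π).map (fun a (i : Fin (N + 1)) => a i) =
      Measure.pi fun _ => π := by
    rw [Measure.map_infinitePi_infinitePi_of_inj (f := Fin.val) Fin.val_injective,
      Measure.infinitePi_eq_pi]
  have hb := (hH.bddMeasurable_prod_moment T).comp (g := fun x : Fin (N + 1) → Ω =>
    x ∘ Fin.ofNat (N + 1)) (measurable_pi_lambda _ fun j => measurable_pi_apply _)
  rw [← hpi, integral_map (Measurable.aemeasurable (by fun_prop))
    hb.measurable.aestronglyMeasurable]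
  congr! 2 with a
  refine congrArg List.prod (List.map_congr_left fun t ht => moment_congr t fun j hj => ?_)
  simp [Nat.mod_eq_of_lt (Nat.lt_succ_of_le (hN t ht j hj))]

section DensityEq

variable {Ω' : Type*} [MeasurableSpace Ω'] {π' : Measure Ω'} [IsProbabilityMeasure π']
  {H : Graphon Ω π} {H' : Graphon Ω' π'}

theorem integral_weight_eq_of_density_eq (hH : H.IsStrong) (hH' : H'.IsStrong)
    (hd : ∀ (k : ℕ) (F : SimpleGraph (Fin k)), H.density F = H'.density F)
    (D : DecoratedGraph n) :
    ∫ x, H.weight D x ∂(Measure.pi fun _ => π) =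
      ∫ x, H'.weight D x ∂(Measure.pi fun _ => π') := by
  induction hm : D.convEdges.length generalizing n with
  | zero =>
    have hD := List.length_eq_zero_iff.1 hm
    rw [← H.density_fromEdgeSet D hD, ← H'.density_fromEdgeSet D hD, hd]
  | succ m ih =>
    obtain ⟨⟨i, j⟩, l, hl⟩ := List.exists_cons_of_length_eq_add_one hm
    have hij : i ≠ j := D.fst_ne_snd (i, j) (by simp [hl])
    let D₀ : DecoratedGraph n :=
      ⟨D.edges, D.not_isDiag, l, fun p hp => D.fst_ne_snd p (by simp [hl, hp])⟩
    rw [hH.integral_weight_of_convEdges_eq_cons (D := D) (D₀ := D₀) hij rfl hl,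
      hH'.integral_weight_of_convEdges_eq_cons (D := D) (D₀ := D₀) hij rfl hl]
    refine ih _ ?_
    simpa [hl, D₀, DecoratedGraph.adjoin] using hm

theorem integral_weight_mul_prod_moment_eq_of_density_eq {ι : Type*} (hH : H.IsStrong)
    (hH' : H'.IsStrong)
    (hd : ∀ (k : ℕ) (F : SimpleGraph (Fin k)), H.density F = H'.density F)
    (D : DecoratedGraph n) (c : ι → Fin n) (T : List (MomentIndex ι)) :
    ∫ x, H.weight D x * (T.map fun t => H.moment t (x ∘ c)).prod ∂(Measure.pi fun _ => π) =
      ∫ x, H'.weight D x * (T.map fun t => H'.moment t (x ∘ c)).prod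
        ∂(Measure.pi fun _ => π') := by
  induction T generalizing n with
  | nil => simpa using integral_weight_eq_of_density_eq hH hH' hd D
  | cons t T ih =>
    simp only [List.map_cons, List.prod_cons]
    rw [hH.integral_weight_mul_moment_mul D c t (hH.bddMeasurable_prod_moment T),
      hH'.integral_weight_mul_moment_mul D c t (hH'.bddMeasurable_prod_moment T)]
    exact ih _ _

theorem integral_prod_moment_eq_of_density_eq (hH : H.IsStrong) (hH' : H'.IsStrong)
    (hd : ∀ (k : ℕ) (F : SimpleGraph (Fin k)), H.density F = H'.density F)
    (T : List (MomentIndex ℕ)) :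
    ∫ a, (T.map fun t => H.moment t a).prod ∂(Measure.infinitePi fun _ : ℕ => π) =
      ∫ a, (T.map fun t => H'.moment t a).prod ∂(Measure.infinitePi fun _ : ℕ => π') := by
  obtain ⟨N, hN⟩ : ∃ N : ℕ, ∀ t ∈ T, ∀ j ∈ t.2.1 ++ t.2.2, j ≤ N :=
    ⟨(T.flatMap fun t => t.2.1 ++ t.2.2).toFinset.sup id, fun t ht j hj =>
      Finset.le_sup (f := id) (List.mem_toFinset.2 (List.mem_flatMap.2 ⟨t, ht, hj⟩))⟩
  rw [hH.integral_prod_moment_infinitePi T hN, hH'.integral_prod_moment_infinitePi T hN]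
  simpa [weight] using integral_weight_mul_prod_moment_eq_of_density_eq hH hH' hd
    ⟨∅, by simp, [], by simp⟩ (Fin.ofNat (N + 1)) T

end DensityEq

end Graphon

section AlmostEverywhere

variable {α : Type*} [MeasurableSpace α] {μ : Measure α}

theorem ae_tendsto_zero_of_tsum_lintegral_ne_top {g : ℕ → α → ℝ≥0∞}
    (hg : ∀ k, AEMeasurable (g k) μ) (h : ∑' k, ∫⁻ x, g k x ∂μ ≠ ⊤) :
    ∀ᵐ x ∂μ, Filter.Tendsto (fun k => g k x) Filter.atTop (nhds 0) := by
  rw [← lintegral_tsum hg] at h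
  filter_upwards [ae_lt_top' (AEMeasurable.tsum hg) h] with x hx
  exact ENNReal.tendsto_atTop_zero_of_tsum_ne_top hx.ne

theorem ae_tendsto_of_integral_sq_lt {g : ℕ → α → ℝ} {f : α → ℝ}
    (hi : ∀ k, Integrable (fun x => (g k x - f x) ^ 2) μ)
    (h : ∀ k, ∫ x, (g k x - f x) ^ 2 ∂μ < (1 / 2) ^ k) :
    ∀ᵐ x ∂μ, Filter.Tendsto (fun k => g k x) Filter.atTop (nhds (f x)) := by
  have hle : ∀ k, ∫⁻ x, ENNReal.ofReal ((g k x - f x) ^ 2) ∂μ ≤ ENNReal.ofReal ((1 / 2) ^ k) := by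
    intro k
    rw [← ofReal_integral_eq_lintegral_ofReal (hi k) (.of_forall fun x => sq_nonneg _)]
    exact ENNReal.ofReal_le_ofReal (h k).le
  have hsum : ∑' k : ℕ, ENNReal.ofReal ((1 / 2) ^ k) ≠ ⊤ := by
    rw [← ENNReal.ofReal_tsum_of_nonneg (fun k => by positivity) summable_geometric_two]
    exact ENNReal.ofReal_ne_top
  filter_upwards [ae_tendsto_zero_of_tsum_lintegral_ne_top
    (fun k => (hi k).aestronglyMeasurable.aemeasurable.ennreal_ofReal)
    (ne_top_of_le_ne_top hsum (ENNReal.tsum_le_tsum hle))] with x hx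
  have hsq := ((ENNReal.tendsto_toReal ENNReal.zero_ne_top).comp hx).sqrt
  simp only [Function.comp_def, ENNReal.toReal_ofReal (sq_nonneg _), ENNReal.toReal_zero,
    Real.sqrt_sq_eq_abs, Real.sqrt_zero] at hsq
  exact tendsto_iff_norm_sub_tendsto_zero.2 hsq

theorem ae_measure_preimage_ball_ne_zero {E : Type*} [PseudoMetricSpace E]
    [TopologicalSpace.SeparableSpace E] (μ : Measure α) (F : α → E) {ε : ℝ} (hε : 0 < ε) :
    ∀ᵐ y ∂μ, μ (F ⁻¹' Metric.ball (F y) ε) ≠ 0 := by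
  obtain ⟨S, hS, hSd⟩ := TopologicalSpace.exists_countable_dense E
  have hnull : μ (⋃ c ∈ {c ∈ S | μ (F ⁻¹' Metric.ball c (ε / 2)) = 0},
      F ⁻¹' Metric.ball c (ε / 2)) = 0 :=
    (measure_biUnion_null_iff (hS.mono fun c hc => hc.1)).2 fun c hc => hc.2
  refine measure_mono_null (fun y hy => ?_) hnull
  obtain ⟨c, hcS, hc⟩ := hSd.exists_dist_lt (F y) (half_pos hε)
  have hsub : F ⁻¹' Metric.ball c (ε / 2) ⊆ F ⁻¹' Metric.ball (F y) ε := fun z hz =>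
    (dist_triangle_right _ _ c).trans_lt (by linarith [Metric.mem_ball.1 hz])
  exact Set.mem_biUnion ⟨hcS, measure_mono_null hsub (not_not.1 hy)⟩ hc

theorem ae_infinitePi_exists_mem [IsProbabilityMeasure μ] {S : Set α} (hS : MeasurableSet S)
    (h0 : μ S ≠ 0) : ∀ᵐ a ∂(Measure.infinitePi fun _ : ℕ => μ), ∃ j, a j ∈ S := by
  have hlt : μ Sᶜ < 1 := by
    rw [prob_compl_eq_one_sub hS]
    exact ENNReal.sub_lt_self ENNReal.one_ne_top one_ne_zero h0
  have hle (n : ℕ) : (Measure.infinitePi fun _ : ℕ => μ) {a | ¬ ∃ j, a j ∈ S} ≤ μ Sᶜ ^ n := by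
    have := Measure.infinitePi_pi (fun _ : ℕ => μ) (s := Finset.range n) (t := fun _ => Sᶜ)
      (fun _ _ => hS.compl)
    simp only [Finset.prod_const, Finset.card_range] at this
    rw [← this]
    exact measure_mono fun a ha i _ hi => ha ⟨i, hi⟩
  exact le_antisymm (ge_of_tendsto' (ENNReal.tendsto_pow_atTop_nhds_zero_of_lt_one hlt) hle)
    zero_le

open scoped Classical in
theorem exists_measurable_choice_nat {p : α → ℕ → Prop}
    (hp : ∀ j, MeasurableSet {x | p x j}) :
    ∃ J : α → ℕ, Measurable J ∧ ∀ x, (∃ j, p x j) → p x (J x) := by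
  have hex (x : α) : ∃ j, p x j ∨ ∀ i, ¬ p x i := by
    by_cases h : ∃ j, p x j
    · exact h.imp fun j hj => Or.inl hj
    · exact ⟨0, Or.inr (not_exists.1 h)⟩
  refine ⟨fun x => Nat.find (hex x), measurable_find _ fun j =>
    (hp j).union ?_, fun x hx => ?_⟩
  · change MeasurableSet {x | ∀ i, ¬ p x i}
    rw [Set.ofPred_forall]
    exact .iInter fun i => (hp i).compl
  · exact (Nat.find_spec (hex x)).resolve_right fun h => hx.elim h

theorem exists_factor_of_factor_right {W : α → α → ℝ} [StandardBorelSpace α]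
    [IsProbabilityMeasure μ] (hW : Measurable fun z : α × α => W z.1 z.2)
    (hsymm : ∀ x y, W x y = W y x) {K : Type*} [MeasurableSpace K] {φ : α → K}
    (hφ : Measurable φ) {L : α × K → ℝ} (hL : Measurable L)
    (h : ∀ᵐ y ∂μ, ∀ᵐ x ∂μ, W x y = L (x, φ y)) :
    ∃ U : K × K → ℝ, Measurable U ∧ ∀ᵐ z ∂μ.prod μ, W z.1 z.2 = U (φ z.1, φ z.2) := by
  have := nonempty_of_isProbabilityMeasure μ
  let κ := ProbabilityTheory.condDistrib id φ μ
  -- As `W(x, y) = L(y, φ x)` too, averaging `L(x, φ y)` over the fibre of `x` does not change it.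
  let U : K × K → ℝ := fun p => ∫ z, L (z, p.2) ∂(κ p.1)
  have hU : Measurable U :=
    (StronglyMeasurable.integral_kernel_prod_right' (f := fun q : (K × K) × α => L (q.2, q.1.2))
      (κ := ProbabilityTheory.Kernel.prodMkRight K κ)
      (by fun_prop : Measurable _).stronglyMeasurable).measurable
  have hLW : MeasurableSet {z : α × α | W z.1 z.2 = L (z.1, φ z.2)} :=
    measurableSet_eq_fun hW (by fun_prop)
  have hWU : MeasurableSet {z : α × α | W z.1 z.2 = U (φ z.1, φ z.2)} :=
    measurableSet_eq_fun hW (by fun_prop)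
  refine ⟨U, hU, (Measure.ae_prod_iff_ae_ae hWU).2 ((Measure.ae_ae_comm hWU).2 ?_)⟩
  filter_upwards [h, (Measure.ae_ae_comm hLW).2 h] with y hright hleft
  have hfib : ∀ᵐ p ∂(μ.map fun x => (φ x, id x)), L (p.2, φ y) = L (y, p.1) := by
    rw [ae_map_iff (by fun_prop) (measurableSet_eq_fun (by fun_prop) (by fun_prop))]
    filter_upwards [hright, hleft] with x hr hl
    rw [id, ← hr, ← hl, hsymm]
  rw [← ProbabilityTheory.compProd_map_condDistrib aemeasurable_id] at hfib
  have havg : ∀ᵐ u ∂(μ.map φ), U (u, φ y) = L (y, u) := by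
    filter_upwards [Measure.ae_ae_of_ae_compProd hfib] with u hu
    simp only [U]
    rw [integral_congr_ae hu]
    simp
  filter_upwards [ae_of_ae_map hφ.aemeasurable havg, hleft] with x hx hl
  rw [hx, hsymm, hl]

end AlmostEverywhere

namespace Graphon

variable {Ω : Type*} [MeasurableSpace Ω] {π : Measure Ω} [IsProbabilityMeasure π]

/-- The squared `L²`-distance of the sections of `W` at two points. -/
noncomputable def sectionDist (H : Graphon Ω π) (y z : Ω) : ℝ :=
  ∫ x, (H.W x y - H.W x z) ^ 2 ∂π

/-- The map `x ↦ (conv(x, a_j))_j` recording the position of a point relative to the anchors. -/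
noncomputable def anchorMap (H : Graphon Ω π) (a : ℕ → Ω) (x : Ω) : ℕ → ℝ :=
  fun j => H.conv x (a j)

variable {H : Graphon Ω π}

theorem IsStrong.bddMeasurable_section (hH : H.IsStrong) (y : Ω) :
    BddMeasurable fun x => H.W x y :=
  hH.bddMeasurable_W measurable_id measurable_const

theorem IsStrong.sectionDist_eq (hH : H.IsStrong) (y z : Ω) :
    H.sectionDist y z = H.conv y y - 2 * H.conv y z + H.conv z z := by
  have hi (u v : Ω) : Integrable (fun x => H.W u x * H.W x v) π :=
    ((hH.bddMeasurable_W measurable_const measurable_id).mul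
      (hH.bddMeasurable_section v)).integrable π
  have hexp (x : Ω) : (H.W x y - H.W x z) ^ 2 =
      H.W y x * H.W x y - 2 * (H.W y x * H.W x z) + H.W z x * H.W x z := by
    rw [H.symm y x, H.symm z x]; ring
  simp only [sectionDist, conv, hexp]
  rw [integral_add (by exact (hi y y).sub ((hi y z).const_mul 2)) (hi z z),
    integral_sub (hi y y) ((hi y z).const_mul 2), integral_const_mul]

theorem IsStrong.measurable_sectionDist (hH : H.IsStrong) :
    Measurable fun p : Ω × Ω => H.sectionDist p.1 p.2 := by
  simp only [hH.sectionDist_eq]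
  exact ((hH.bddMeasurable_conv measurable_fst measurable_fst).measurable.sub
    ((hH.bddMeasurable_conv measurable_fst measurable_snd).measurable.const_mul 2)).add
    (hH.bddMeasurable_conv measurable_snd measurable_snd).measurable

theorem IsStrong.integrable_section_sub_sq (hH : H.IsStrong) (y z : Ω) :
    Integrable (fun x => (H.W x y - H.W x z) ^ 2) π := by
  have h : BddMeasurable fun x => H.W x y - H.W x z :=
    (hH.bddMeasurable_section y).sub (hH.bddMeasurable_section z)
  simpa only [sq] using (h.mul h).integrable π

theorem IsStrong.exists_toLp_section (hH : H.IsStrong) :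
    ∃ F : Ω → Lp ℝ 2 π, ∀ y z, H.sectionDist y z = dist (F y) (F z) ^ 2 := by
  have hmem (y : Ω) : MemLp (fun x => H.W x y) 2 π := by
    have h := hH.bddMeasurable_section y
    refine (memLp_two_iff_integrable_sq h.measurable.aestronglyMeasurable).2 ?_
    simpa only [sq] using (h.mul h).integrable π
  refine ⟨fun y => (hmem y).toLp, fun y z => ?_⟩
  rw [dist_eq_norm, ← MemLp.toLp_sub, ← real_inner_self_eq_norm_sq, L2.inner_def]
  refine integral_congr_ae ?_
  filter_upwards [((hmem y).sub (hmem z)).coeFn_toLp] with x hx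
  simp [hx, sq]

theorem IsStrong.ae_measure_sectionDist_lt_ne_zero [MeasurableSpace.CountablyGenerated Ω]
    (hH : H.IsStrong) {ε : ℝ} (hε : 0 < ε) : ∀ᵐ y ∂π, π {z | H.sectionDist y z < ε} ≠ 0 := by
  obtain ⟨F, hF⟩ := hH.exists_toLp_section
  have : Fact ((2 : ℝ≥0∞) ≠ ⊤) := ⟨ENNReal.ofNat_ne_top⟩
  filter_upwards [ae_measure_preimage_ball_ne_zero π F (Real.sqrt_pos.2 hε)] with y hy
  have hball : {z | H.sectionDist y z < ε} = F ⁻¹' Metric.ball (F y) √ε := by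
    ext z
    simp [hF, dist_comm (F z), Real.lt_sqrt dist_nonneg]
  rwa [hball]

theorem IsStrong.ae_infinitePi_dense [MeasurableSpace.CountablyGenerated Ω] (hH : H.IsStrong) :
    ∀ᵐ a ∂(Measure.infinitePi fun _ : ℕ => π), ∀ᵐ y ∂π,
      ∀ k : ℕ, ∃ j, H.sectionDist y (a j) < (1 / 2) ^ k := by
  have hm : MeasurableSet {p : Ω × (ℕ → Ω) |
      ∀ k : ℕ, ∃ j, H.sectionDist p.1 (p.2 j) < (1 / 2) ^ k} := by
    simp only [Set.ofPred_forall, Set.ofPred_exists]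
    refine .iInter fun k => .iUnion fun j => measurableSet_lt ?_ measurable_const
    exact hH.measurable_sectionDist.comp (f := fun p : Ω × (ℕ → Ω) => (p.1, p.2 j)) (by fun_prop)
  rw [← Measure.ae_ae_comm hm]
  have hpos : ∀ᵐ y ∂π, ∀ k : ℕ, π {z | H.sectionDist y z < (1 / 2) ^ k} ≠ 0 :=
    ae_all_iff.2 fun k => hH.ae_measure_sectionDist_lt_ne_zero (by positivity)
  filter_upwards [hpos] with y hy
  exact ae_all_iff.2 fun k => ae_infinitePi_exists_mem (measurableSet_lt
    (hH.measurable_sectionDist.comp (by fun_prop : Measurable fun z => (y, z)))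
    measurable_const) (hy k)

theorem IsStrong.measurable_anchorMap (hH : H.IsStrong) (a : ℕ → Ω) : Measurable (H.anchorMap a) :=
  measurable_pi_lambda _ fun _ => (hH.bddMeasurable_conv measurable_id measurable_const).measurable

theorem IsStrong.iSup_anchorMap (hH : H.IsStrong) {a : ℕ → Ω} {y : Ω}
    (hy : ∀ k : ℕ, ∃ j, H.sectionDist y (a j) < (1 / 2) ^ k) :
    ⨆ j, (2 * H.anchorMap a y j - H.conv (a j) (a j)) = H.conv y y := by
  refine ciSup_eq_of_forall_le_of_forall_lt_exists_gt (fun j => ?_) fun w hw => ?_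
  · have h0 : 0 ≤ H.sectionDist y (a j) := integral_nonneg fun x => sq_nonneg _
    rw [hH.sectionDist_eq] at h0
    simp only [anchorMap]
    linarith
  · obtain ⟨k, hk⟩ := exists_pow_lt_of_lt_one (sub_pos.2 hw) (by norm_num : (1 / 2 : ℝ) < 1)
    obtain ⟨j, hj⟩ := hy k
    rw [hH.sectionDist_eq] at hj
    exact ⟨j, by simp only [anchorMap]; linarith⟩

-- `conv(y, y)` is a supremum of functions of the anchor values, hence so is the distance of the
-- sections at `y` and at an anchor.
theorem IsStrong.exists_measurable_nearby_anchor (hH : H.IsStrong) (a : ℕ → Ω) :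
    ∃ J : ℕ → (ℕ → ℝ) → ℕ, (∀ k, Measurable (J k)) ∧
      ∀ y, (∀ k : ℕ, ∃ j, H.sectionDist y (a j) < (1 / 2) ^ k) →
        ∀ k, H.sectionDist y (a (J k (H.anchorMap a y))) < (1 / 2) ^ k := by
  let s : (ℕ → ℝ) → ℝ := fun v => ⨆ j, (2 * v j - H.conv (a j) (a j))
  have hs : Measurable s := Measurable.iSup fun j => by fun_prop
  choose J hJm hJ using fun k : ℕ => exists_measurable_choice_nat
    (p := fun v j => s v - 2 * v j + H.conv (a j) (a j) < (1 / 2) ^ k) fun j =>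
      measurableSet_lt (by fun_prop) measurable_const
  refine ⟨J, hJm, fun y hy k => ?_⟩
  have hdist (j : ℕ) : H.sectionDist y (a j) =
      s (H.anchorMap a y) - 2 * H.anchorMap a y j + H.conv (a j) (a j) := by
    simp only [s, hH.iSup_anchorMap hy, hH.sectionDist_eq, anchorMap]
  rw [hdist]
  exact hJ k _ ((hy k).imp fun j hj => hdist j ▸ hj)

theorem IsStrong.exists_factor_right_anchorMap (hH : H.IsStrong) (a : ℕ → Ω) :
    ∃ L : Ω × (ℕ → ℝ) → ℝ, Measurable L ∧
      ∀ y, (∀ k : ℕ, ∃ j, H.sectionDist y (a j) < (1 / 2) ^ k) →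
        ∀ᵐ x ∂π, H.W x y = L (x, H.anchorMap a y) := by
  obtain ⟨J, hJm, hJ⟩ := hH.exists_measurable_nearby_anchor a
  refine ⟨fun q => Filter.limsup (fun k => H.W q.1 (a (J k q.2))) Filter.atTop,
    Measurable.limsup fun k => ?_, fun y hy => ?_⟩
  · have hW : Measurable fun q : Ω × ℕ => H.W q.1 (a q.2) :=
      measurable_from_prod_countable_left fun j => (hH.bddMeasurable_section (a j)).measurable
    exact hW.comp (f := fun q : Ω × (ℕ → ℝ) => (q.1, J k q.2)) (by fun_prop)
  · have hlt (k : ℕ) :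
        ∫ x, (H.W x (a (J k (H.anchorMap a y))) - H.W x y) ^ 2 ∂π < (1 / 2) ^ k := by
      simpa only [sectionDist, sub_sq_comm] using hJ y hy k
    filter_upwards [ae_tendsto_of_integral_sq_lt (fun k => hH.integrable_section_sub_sq _ _) hlt]
      with x hx
    exact hx.limsup_eq.symm

theorem IsStrong.ae_exists_factor_anchorMap [StandardBorelSpace Ω] (hH : H.IsStrong) :
    ∀ᵐ a ∂(Measure.infinitePi fun _ : ℕ => π), ∃ U : (ℕ → ℝ) × (ℕ → ℝ) → ℝ, Measurable U ∧
      ∀ᵐ z ∂π.prod π, H.W z.1 z.2 = U (H.anchorMap a z.1, H.anchorMap a z.2) := by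
  filter_upwards [hH.ae_infinitePi_dense] with a ha
  obtain ⟨L, hL, hfactor⟩ := hH.exists_factor_right_anchorMap a
  exact exists_factor_of_factor_right hH H.symm (hH.measurable_anchorMap a) hL
    (ha.mono hfactor)

end Graphon

section MomentProblem

theorem measure_eq_of_forall_integral_list_prod_eq {X ι : Type*} [TopologicalSpace X]
    [PolishSpace X] [MeasurableSpace X] [BorelSpace X] {μ ν : Measure X} [IsFiniteMeasure μ]
    [IsFiniteMeasure ν] (e : ι → BoundedContinuousFunction X ℝ)
    (hsep : ∀ x y, x ≠ y → ∃ i, e i x ≠ e i y)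
    (h : ∀ l : List ι, ∫ x, (l.map e).prod x ∂μ = ∫ x, (l.map e).prod x ∂ν) : μ = ν := by
  refine ext_of_forall_mem_subalgebra_integral_eq_of_polish (𝕜 := ℝ)
    (A := StarAlgebra.adjoin ℝ (Set.range e)) ?_ fun g hg => ?_
  · intro x y hxy
    obtain ⟨i, hi⟩ := hsep x y hxy
    exact ⟨e i, ⟨(e i).toContinuousMap, ⟨e i, StarAlgebra.subset_adjoin ℝ _ ⟨i, rfl⟩, rfl⟩, rfl⟩,
      hi⟩
  have hstar : star (Set.range e) = Set.range e := by
    ext f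
    rw [Set.mem_star, show star f = f from BoundedContinuousFunction.ext fun x => rfl]
  have hspan : g ∈ Submodule.span ℝ (Submonoid.closure (Set.range e) : Set _) := by
    rwa [← Algebra.adjoin_eq_span, Subalgebra.mem_toSubmodule, ← Set.union_self (Set.range e),
      ← congrArg (Set.range e ∪ ·) hstar, ← StarAlgebra.adjoin_toSubalgebra]
  clear hg
  induction hspan using Submodule.span_induction with
  | mem f hf =>
    obtain ⟨l, hl, rfl⟩ := Submonoid.exists_list_of_mem_closure hf
    obtain ⟨l, rfl⟩ : l ∈ Set.range (List.map e) := by rwa [Set.range_list_map]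
    exact h l
  | zero => simp
  | add f g _ _ hf hg =>
    simp only [BoundedContinuousFunction.coe_add, Pi.add_apply]
    rw [integral_add (f.integrable _) (g.integrable _),
      integral_add (f.integrable _) (g.integrable _), hf, hg]
  | smul r f _ hf =>
    simp only [BoundedContinuousFunction.coe_smul, smul_eq_mul, integral_const_mul, hf]

variable {α β ι κ : Type*} [MeasurableSpace α] [MeasurableSpace β] [Countable ι] [Countable κ]
  {μ : Measure α} {ν : Measure β} [IsFiniteMeasure μ] [IsFiniteMeasure ν]

theorem map_eq_map_of_forall_integral_list_prod_eq {f : ι → α → ℝ} {g : ι → β → ℝ}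
    (hf : ∀ i, BddMeasurable (f i)) (hg : ∀ i, BddMeasurable (g i))
    (h : ∀ l : List ι, ∫ x, (l.map fun i => f i x).prod ∂μ =
      ∫ y, (l.map fun i => g i y).prod ∂ν) :
    μ.map (fun x i => f i x) = ν.map (fun y i => g i y) := by
  choose B hB using fun i => (hf i).bounded
  choose B' hB' using fun i => (hg i).bounded
  let X := ∀ i, Set.Icc (-max (B i) (B' i)) (max (B i) (B' i))
  let e (i : ι) : BoundedContinuousFunction X ℝ := .mkOfCompact ⟨fun x => (x i : ℝ), by fun_prop⟩
  let c (x : α) : X := fun i => ⟨f i x, abs_le.1 ((hB i x).trans (le_max_left _ _))⟩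
  let d (y : β) : X := fun i => ⟨g i y, abs_le.1 ((hB' i y).trans (le_max_right _ _))⟩
  have hc : Measurable c := measurable_pi_lambda _ fun i => (hf i).measurable.subtype_mk
  have hd : Measurable d := measurable_pi_lambda _ fun i => (hg i).measurable.subtype_mk
  have hprod (l : List ι) (x : X) : (l.map e).prod x = (l.map fun i => e i x).prod := by
    induction l with
    | nil => rfl
    | cons i l ih => simp [ih]
  have hcd : μ.map c = ν.map d := by
    refine measure_eq_of_forall_integral_list_prod_eq e (fun x y hxy => ?_) fun l => ?_
    · obtain ⟨i, hi⟩ := Function.ne_iff.1 hxy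
      exact ⟨i, Subtype.coe_ne_coe.2 hi⟩
    · rw [integral_map hc.aemeasurable (map_continuous _).measurable.aestronglyMeasurable,
        integral_map hd.aemeasurable (map_continuous _).measurable.aestronglyMeasurable]
      simp only [hprod]
      exact h l
  have hval : Measurable fun (x : X) i => (x i : ℝ) := by fun_prop
  have := congrArg (Measure.map fun (x : X) i => (x i : ℝ)) hcd
  rwa [Measure.map_map hval hc, Measure.map_map hval hd] at this

theorem list_prod_map_sumElim {ι κ γ M : Type*} [CommMonoid M] (u : ι → γ → M) (v : κ → γ → M)
    (z : γ) (l : List (ι ⊕ κ)) :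
    (l.map fun s => Sum.elim u v s z).prod =
      ((l.filterMap Sum.getLeft?).map fun i => u i z).prod *
        ((l.filterMap Sum.getRight?).map fun j => v j z).prod := by
  induction l with
  | nil => simp
  | cons i l ih =>
    rcases i with i | i <;> simp [List.filterMap_cons, ih, mul_assoc, mul_left_comm]

theorem map_prodMk_eq_of_forall_integral_list_prod_eq {f₁ : ι → α → ℝ} {f₂ : κ → α → ℝ}
    {g₁ : ι → β → ℝ} {g₂ : κ → β → ℝ} (hf₁ : ∀ i, BddMeasurable (f₁ i))
    (hf₂ : ∀ j, BddMeasurable (f₂ j)) (hg₁ : ∀ i, BddMeasurable (g₁ i))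
    (hg₂ : ∀ j, BddMeasurable (g₂ j))
    (h : ∀ (l : List ι) (m : List κ),
      ∫ x, (l.map fun i => f₁ i x).prod * (m.map fun j => f₂ j x).prod ∂μ =
        ∫ y, (l.map fun i => g₁ i y).prod * (m.map fun j => g₂ j y).prod ∂ν) :
    μ.map (fun x => (fun i => f₁ i x, fun j => f₂ j x)) =
      ν.map (fun y => (fun i => g₁ i y, fun j => g₂ j y)) := by
  have hf : ∀ s, BddMeasurable (Sum.elim f₁ f₂ s) := Sum.forall.2 ⟨hf₁, hf₂⟩
  have hg : ∀ s, BddMeasurable (Sum.elim g₁ g₂ s) := Sum.forall.2 ⟨hg₁, hg₂⟩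
  have hsum := map_eq_map_of_forall_integral_list_prod_eq (μ := μ) (ν := ν) hf hg fun l => by
    simp only [list_prod_map_sumElim, h]
  have hsplit : Measurable fun w : ι ⊕ κ → ℝ => (fun i => w (.inl i), fun j => w (.inr j)) := by
    fun_prop
  have := congrArg (Measure.map fun w : ι ⊕ κ → ℝ => (fun i => w (.inl i), fun j => w (.inr j)))
    hsum
  rwa [Measure.map_map hsplit (measurable_pi_lambda _ fun s => (hf s).measurable),
    Measure.map_map hsplit (measurable_pi_lambda _ fun s => (hg s).measurable)] at this

end MomentProblem

section CommonValue

variable {α β S : Type*} [MeasurableSpace α] [StandardBorelSpace α] [MeasurableSpace β]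
  [StandardBorelSpace β] [MeasurableSpace S] [StandardBorelSpace S] {μ : Measure α}
  [IsProbabilityMeasure μ] {ν : Measure β} [IsProbabilityMeasure ν] {f : α → S} {g : β → S}

theorem ae_map_exists_eq (hf : Measurable f) {p : α → Prop} (hp : ∀ᵐ x ∂μ, p x) :
    ∀ᵐ s ∂(μ.map f), ∃ x, p x ∧ f x = s := by
  have := nonempty_of_isProbabilityMeasure μ
  obtain ⟨t, ht, htm, ht0⟩ := exists_measurable_superset_of_null hp
  have hgraph : ∀ᵐ q ∂(μ.map fun x => (f x, id x)), q.2 ∈ tᶜ ∧ f q.2 = q.1 := by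
    have hm : MeasurableSet {q : S × α | q.2 ∈ tᶜ ∧ f q.2 = q.1} :=
      (measurable_snd htm.compl).inter
        (measurableSet_eq_fun (hf.comp measurable_snd) measurable_fst)
    rw [ae_map_iff (by fun_prop) hm]
    filter_upwards [measure_eq_zero_iff_ae_notMem.1 ht0] with x hx using ⟨hx, rfl⟩
  rw [← ProbabilityTheory.compProd_map_condDistrib aemeasurable_id] at hgraph
  filter_upwards [Measure.ae_ae_of_ae_compProd hgraph] with s hs
  obtain ⟨x, hx, hxs⟩ := hs.exists
  exact ⟨x, not_not.1 fun hn => hx (ht hn), hxs⟩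

theorem exists_eq_of_map_eq (hf : Measurable f) (hg : Measurable g) (h : μ.map f = ν.map g)
    {p : α → Prop} {q : β → Prop} (hp : ∀ᵐ x ∂μ, p x) (hq : ∀ᵐ y ∂ν, q y) :
    ∃ x y, p x ∧ q y ∧ f x = g y := by
  have hpf := ae_map_exists_eq hf hp
  rw [h] at hpf
  have := Measure.isProbabilityMeasure_map (μ := ν) hg.aemeasurable
  obtain ⟨s, ⟨x, hx, hxs⟩, y, hy, hys⟩ := (hpf.and (ae_map_exists_eq hg hq)).exists
  exact ⟨x, y, hx, hy, hxs.trans hys.symm⟩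

end CommonValue

section WithDensity

variable {α β : Type*} [MeasurableSpace α] [MeasurableSpace β]

theorem map_withDensity_ofReal_of_ae_eq_comp {μ : Measure α} {ν : Measure β} {φ : α → β}
    (hφ : MeasurePreserving φ μ ν) {f : α → ℝ} {g : β → ℝ} (hg : Measurable g)
    (h : ∀ᵐ x ∂μ, f x = g (φ x)) :
    (μ.withDensity fun x => ENNReal.ofReal (f x)).map φ =
      ν.withDensity fun y => ENNReal.ofReal (g y) := by
  ext s hs
  rw [Measure.map_apply hφ.measurable hs, withDensity_apply _ (hφ.measurable hs),
    withDensity_apply _ hs, ← hφ.map_eq, setLIntegral_map hs (by fun_prop) hφ.measurable]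
  refine setLIntegral_congr_fun_ae (hφ.measurable hs) ?_
  filter_upwards [h] with x hx _
  rw [hx]

theorem ae_eq_of_withDensity_ofReal_eq {μ : Measure α} [SigmaFinite μ] {f g : α → ℝ}
    (hf : Measurable f) (hg : Measurable g) (hf0 : ∀ᵐ x ∂μ, 0 ≤ f x) (hg0 : ∀ᵐ x ∂μ, 0 ≤ g x)
    (h : (μ.withDensity fun x => ENNReal.ofReal (f x)) =
      μ.withDensity fun x => ENNReal.ofReal (g x)) : f =ᵐ[μ] g := by
  rw [withDensity_eq_iff_of_sigmaFinite (by fun_prop) (by fun_prop)] at h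
  filter_upwards [h, hf0, hg0] with x hx h1 h2 using (ENNReal.ofReal_eq_ofReal_iff h1 h2).1 hx

end WithDensity

namespace Graphon

variable {Ω Ω' : Type*} [MeasurableSpace Ω] [MeasurableSpace Ω']
  {π : Measure Ω} [IsProbabilityMeasure π] {π' : Measure Ω'} [IsProbabilityMeasure π']
  {H : Graphon Ω π} {H' : Graphon Ω' π'}

theorem IsStrong.bddMeasurable_anchorMap {α : Type*} [MeasurableSpace α] (hH : H.IsStrong)
    (a : ℕ → Ω) {f : α → Ω} (hf : Measurable f) (j : ℕ) :
    BddMeasurable fun p => H.anchorMap a (f p) j :=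
  hH.bddMeasurable_conv hf measurable_const

theorem integral_prod_anchorMap (H : Graphon Ω π) (a : ℕ → Ω) (l : List ℕ) :
    ∫ x, (l.map fun j => H.anchorMap a x j).prod ∂π = H.moment (false, l, []) a := by
  have := integral_fun_fst (μ := π) (ν := π) fun x => (l.map fun j => H.anchorMap a x j).prod
  simpa [moment, convProd, anchorMap] using this.symm

theorem map_anchorMap_eq_of_moment_eq (hH : H.IsStrong) (hH' : H'.IsStrong) {a : ℕ → Ω}
    {a' : ℕ → Ω'} (hM : ∀ t, H.moment t a = H'.moment t a') :
    π.map (H.anchorMap a) = π'.map (H'.anchorMap a') :=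
  map_eq_map_of_forall_integral_list_prod_eq (hH.bddMeasurable_anchorMap a measurable_id)
    (hH'.bddMeasurable_anchorMap a' measurable_id) fun l =>
      (H.integral_prod_anchorMap a l).trans ((hM _).trans (H'.integral_prod_anchorMap a' l).symm)

/-- The image under the anchor map, applied to both points of a pair, of the measure with density
`W + C`; the constant `C` makes the density nonnegative. -/
noncomputable def anchorLaw (H : Graphon Ω π) (C : ℝ) (a : ℕ → Ω) : Measure ((ℕ → ℝ) × (ℕ → ℝ)) :=
  ((π.prod π).withDensity fun z => ENNReal.ofReal (H.W z.1 z.2 + C)).map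
    (Prod.map (H.anchorMap a) (H.anchorMap a))

theorem IsStrong.integral_withDensity_prod_anchorMap (hH : H.IsStrong) {C : ℝ}
    (hC : ∀ x y, |H.W x y| ≤ C) (a : ℕ → Ω) (l m : List ℕ) :
    ∫ z, (l.map fun j => H.anchorMap a z.1 j).prod * (m.map fun j => H.anchorMap a z.2 j).prod
        ∂((π.prod π).withDensity fun z => ENNReal.ofReal (H.W z.1 z.2 + C)) =
      H.moment (true, l, m) a + C * H.moment (false, l, m) a := by
  have hint (t : MomentIndex ℕ) := (hH.bddMeasurable_momentIntegrand t (a := fun j _ => a j)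
    (by fun_prop) measurable_fst measurable_snd).integrable (π.prod π)
  rw [integral_withDensity_eq_integral_toReal_smul (Measurable.add_const hH C).ennreal_ofReal
      (.of_forall fun _ => ENNReal.ofReal_lt_top), moment, moment, ← integral_const_mul,
    ← integral_add (hint _) ((hint _).const_mul C)]
  refine integral_congr_ae (.of_forall fun z => ?_)
  have h0 : 0 ≤ H.W z.1 z.2 + C := by linarith [neg_le_of_abs_le (hC z.1 z.2)]
  simp only [ENNReal.toReal_ofReal h0, anchorMap, convProd, smul_eq_mul, if_true,
    Bool.false_eq_true, if_false, one_mul, add_mul]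

theorem anchorLaw_eq_of_moment_eq (hH : H.IsStrong) (hH' : H'.IsStrong) {C : ℝ}
    (hC : ∀ x y, |H.W x y| ≤ C) (hC' : ∀ x y, |H'.W x y| ≤ C) {a : ℕ → Ω} {a' : ℕ → Ω'}
    (hM : ∀ t, H.moment t a = H'.moment t a') : H.anchorLaw C a = H'.anchorLaw C a' := by
  have : IsFiniteMeasure ((π.prod π).withDensity fun z => ENNReal.ofReal (H.W z.1 z.2 + C)) :=
    isFiniteMeasure_withDensity_ofReal (((hH.bddMeasurable_W measurable_fst
      measurable_snd).integrable (π.prod π)).add (integrable_const C)).2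
  have : IsFiniteMeasure ((π'.prod π').withDensity fun z => ENNReal.ofReal (H'.W z.1 z.2 + C)) :=
    isFiniteMeasure_withDensity_ofReal (((hH'.bddMeasurable_W measurable_fst
      measurable_snd).integrable (π'.prod π')).add (integrable_const C)).2
  exact map_prodMk_eq_of_forall_integral_list_prod_eq
    (hH.bddMeasurable_anchorMap a measurable_fst) (hH.bddMeasurable_anchorMap a measurable_snd)
    (hH'.bddMeasurable_anchorMap a' measurable_fst)
    (hH'.bddMeasurable_anchorMap a' measurable_snd) fun l m => by
      rw [hH.integral_withDensity_prod_anchorMap hC, hH'.integral_withDensity_prod_anchorMap hC',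
        hM, hM]

theorem IsStrong.anchorLaw_eq_withDensity (hH : H.IsStrong) (C : ℝ) (a : ℕ → Ω)
    {U : (ℕ → ℝ) × (ℕ → ℝ) → ℝ} (hU : Measurable U)
    (h : ∀ᵐ z ∂π.prod π, H.W z.1 z.2 = U (H.anchorMap a z.1, H.anchorMap a z.2)) :
    H.anchorLaw C a = ((π.map (H.anchorMap a)).prod (π.map (H.anchorMap a))).withDensity
      fun p => ENNReal.ofReal (U p + C) := by
  have hφ : MeasurePreserving (H.anchorMap a) π (π.map (H.anchorMap a)) :=
    ⟨hH.measurable_anchorMap a, rfl⟩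
  have := Measure.isProbabilityMeasure_map (μ := π) hφ.aemeasurable
  refine map_withDensity_ofReal_of_ae_eq_comp (hφ.prod hφ) (hU.add_const C) ?_
  filter_upwards [h] with z hz
  rw [hz]
  rfl

theorem IsStrong.ae_nonneg_factor_add (hH : H.IsStrong) {C : ℝ} (hC : ∀ x y, |H.W x y| ≤ C)
    {a : ℕ → Ω} {U : (ℕ → ℝ) × (ℕ → ℝ) → ℝ} (hU : Measurable U)
    (h : ∀ᵐ z ∂π.prod π, H.W z.1 z.2 = U (H.anchorMap a z.1, H.anchorMap a z.2)) :
    ∀ᵐ p ∂(π.map (H.anchorMap a)).prod (π.map (H.anchorMap a)), 0 ≤ U p + C := by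
  have hφ := hH.measurable_anchorMap a
  rw [Measure.map_prod_map _ _ hφ hφ, ae_map_iff (hφ.prodMap hφ).aemeasurable
    (measurableSet_le measurable_const (hU.add_const C))]
  filter_upwards [h] with z hz
  have hW := neg_le_of_abs_le (hC z.1 z.2)
  rw [hz] at hW
  linarith [show -C ≤ U (Prod.map (H.anchorMap a) (H.anchorMap a) z) from hW]

theorem ae_eq_of_factor_anchorMap (hH : H.IsStrong) (hH' : H'.IsStrong) {a : ℕ → Ω}
    {a' : ℕ → Ω'} (hM : ∀ t, H.moment t a = H'.moment t a')
    {U U' : (ℕ → ℝ) × (ℕ → ℝ) → ℝ} (hU : Measurable U) (hU' : Measurable U')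
    (h : ∀ᵐ z ∂π.prod π, H.W z.1 z.2 = U (H.anchorMap a z.1, H.anchorMap a z.2))
    (h' : ∀ᵐ z ∂π'.prod π', H'.W z.1 z.2 = U' (H'.anchorMap a' z.1, H'.anchorMap a' z.2)) :
    U =ᵐ[(π.map (H.anchorMap a)).prod (π.map (H.anchorMap a))] U' := by
  obtain ⟨C₁, hC₁⟩ := H.bounded
  obtain ⟨C₂, hC₂⟩ := H'.bounded
  have hC x y : |H.W x y| ≤ max C₁ C₂ := (hC₁ x y).trans (le_max_left _ _)
  have hC' x y : |H'.W x y| ≤ max C₁ C₂ := (hC₂ x y).trans (le_max_right _ _)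
  have hlaw := anchorLaw_eq_of_moment_eq hH hH' hC hC' hM
  rw [hH.anchorLaw_eq_withDensity _ a hU h, hH'.anchorLaw_eq_withDensity _ a' hU' h',
    ← map_anchorMap_eq_of_moment_eq hH hH' hM] at hlaw
  have := Measure.isProbabilityMeasure_map (μ := π) (hH.measurable_anchorMap a).aemeasurable
  filter_upwards [ae_eq_of_withDensity_ofReal_eq (hU.add_const _) (hU'.add_const _)
    (hH.ae_nonneg_factor_add hC hU h) (map_anchorMap_eq_of_moment_eq hH hH' hM ▸
      hH'.ae_nonneg_factor_add hC' hU' h') hlaw] with p hp using add_right_cancel hp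

theorem exists_common_factor_of_density_eq [StandardBorelSpace Ω] [StandardBorelSpace Ω']
    (hH : H.IsStrong) (hH' : H'.IsStrong)
    (hd : ∀ (k : ℕ) (F : SimpleGraph (Fin k)), H.density F = H'.density F) :
    ∃ (ρ : Measure (ℕ → ℝ)) (φ : Ω → ℕ → ℝ) (φ' : Ω' → ℕ → ℝ) (U : (ℕ → ℝ) × (ℕ → ℝ) → ℝ),
      MeasurePreserving φ π ρ ∧ MeasurePreserving φ' π' ρ ∧ Measurable U ∧
      (∀ᵐ z ∂π.prod π, H.W z.1 z.2 = U (φ z.1, φ z.2)) ∧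
      ∀ᵐ z ∂π'.prod π', H'.W z.1 z.2 = U (φ' z.1, φ' z.2) := by
  have hm : Measurable fun a (t : MomentIndex ℕ) => H.moment t a :=
    measurable_pi_lambda _ fun t => (hH.bddMeasurable_moment t).measurable
  have hm' : Measurable fun a (t : MomentIndex ℕ) => H'.moment t a :=
    measurable_pi_lambda _ fun t => (hH'.bddMeasurable_moment t).measurable
  have hlaw : (Measure.infinitePi fun _ : ℕ => π).map (fun a t => H.moment t a) =
      (Measure.infinitePi fun _ : ℕ => π').map (fun a t => H'.moment t a) :=
    map_eq_map_of_forall_integral_list_prod_eq hH.bddMeasurable_moment hH'.bddMeasurable_moment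
      (integral_prod_moment_eq_of_density_eq hH hH' hd)
  obtain ⟨a, a', ⟨U, hU, hUW⟩, ⟨U', hU', hUW'⟩, haa⟩ := exists_eq_of_map_eq hm hm' hlaw
    hH.ae_exists_factor_anchorMap hH'.ae_exists_factor_anchorMap
  have hM : ∀ t, H.moment t a = H'.moment t a' := congrFun haa
  have hφ : MeasurePreserving (H.anchorMap a) π (π.map (H.anchorMap a)) :=
    ⟨hH.measurable_anchorMap a, rfl⟩
  have hφ' : MeasurePreserving (H'.anchorMap a') π' (π.map (H.anchorMap a)) :=
    ⟨hH'.measurable_anchorMap a', (map_anchorMap_eq_of_moment_eq hH hH' hM).symm⟩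
  have := Measure.isProbabilityMeasure_map (μ := π) hφ.aemeasurable
  refine ⟨_, _, _, U', hφ, hφ', hU', ?_, hUW'⟩
  filter_upwards [hUW, (hφ.prod hφ).quasiMeasurePreserving.ae
    (ae_eq_of_factor_anchorMap hH hH' hM hU hU' hUW hUW')] with z h1 h2 using h1.trans h2

theorem exists_isWeakIso_of_density_eq
    (hd : ∀ (k : ℕ) (F : SimpleGraph (Fin k)), H.density F = H'.density F) {a b : ℝ}
    (hab : a ≤ b) (hH : ∀ x y, H.W x y ∈ Set.Icc a b) :
    ∃ (ρ : Measure (ℕ → ℝ)) (_ : IsProbabilityMeasure ρ) (G : Graphon (ℕ → ℝ) ρ)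
      (φ : Ω → ℕ → ℝ) (φ' : Ω' → ℕ → ℝ), G.IsStrong ∧
      (∀ x y, G.W x y ∈ Set.Icc a b) ∧ H.IsWeakIso G φ ∧ H'.IsWeakIso G φ' := by
  obtain ⟨ρ₀, _, G₀, ψ, hG₀, hψ⟩ := H.exists_isWeakIso_standardBorel
  obtain ⟨ρ₀', _, G₀', ψ', hG₀', hψ'⟩ := H'.exists_isWeakIso_standardBorel
  obtain ⟨ρ, φ, φ', U, hφ, hφ', hU, hUG, hUG'⟩ := exists_common_factor_of_density_eq hG₀ hG₀'
    fun k F => by rw [← hψ.density_eq, ← hψ'.density_eq, hd]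
  rw [isWeakIso_iff] at hψ hψ'
  have hφψ := (NullMeasurePreserving.of_measurePreserving hφ).comp hψ.1
  have hφψ' := (NullMeasurePreserving.of_measurePreserving hφ').comp hψ'.1
  have hρ : IsProbabilityMeasure ρ := hφψ.isProbabilityMeasure
  have hHU : ∀ᵐ z ∂π.prod π, H.W z.1 z.2 = U (φ (ψ z.1), φ (ψ z.2)) := by
    filter_upwards [hψ.2, (hψ.1.prodMap hψ.1).ae hUG] with z h1 h2 using h1.trans h2
  have hHU' : ∀ᵐ z ∂π'.prod π', H'.W z.1 z.2 = U (φ' (ψ' z.1), φ' (ψ' z.2)) := by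
    filter_upwards [hψ'.2, (hψ'.1.prodMap hψ'.1).ae hUG'] with z h1 h2 using h1.trans h2
  refine ⟨ρ, hρ, ofKernel ρ hU hab, φ ∘ ψ, φ' ∘ ψ', isStrong_ofKernel, ofKernel_mem_Icc,
    isWeakIso_ofKernel hφψ hHU hH, isWeakIso_iff.2 ⟨hφψ', ?_⟩⟩
  filter_upwards [hHU', (hφψ'.prodMap hφψ').ae (ofKernel_ae_eq (hab := hab) hφψ hHU hH)]
    with z h1 h2 using h1.trans h2.symm

theorem density_eq_of_weaklyIsomorphic (h : H.WeaklyIsomorphic H') {k : ℕ}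
    (F : SimpleGraph (Fin k)) : H.density F = H'.density F := by
  obtain ⟨Γ, _, ρ, _, G, φ, ψ, h1, h2⟩ := h
  rw [h1.density_eq, h2.density_eq]

theorem weaklyIsomorphic_of_density_eq
    (hd : ∀ (k : ℕ) (F : SimpleGraph (Fin k)), H.density F = H'.density F) :
    WeaklyIsomorphic.{_, _, w} H H' := by
  obtain ⟨a, b, hab, hH⟩ := H.exists_forall_mem_Icc
  obtain ⟨ρ, _, G, φ, φ', hG, hb, hφ, hφ'⟩ := exists_isWeakIso_of_density_eq hd hab hH
  have hup : MeasurePreserving (ULift.up.{w} : (ℕ → ℝ) → ULift.{w} (ℕ → ℝ)) ρ (ρ.map ULift.up) :=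
    ⟨measurable_up, rfl⟩
  have := Measure.isProbabilityMeasure_map (μ := ρ) hup.aemeasurable
  have hdown : Measurable fun z : ULift.{w} (ℕ → ℝ) × ULift.{w} (ℕ → ℝ) =>
      G.W z.1.down z.2.down :=
    hG.comp (measurable_down.prodMap measurable_down)
  have hweak : G.IsWeakIso (ofKernel (ρ.map ULift.up) hdown hab) ULift.up :=
    isWeakIso_ofKernel (.of_measurePreserving hup) (.of_forall fun _ => rfl) hb
  exact ⟨_, _, _, this, _, _, _, hweak.comp hφ, hweak.comp hφ'⟩

end Graphon

section Inverses

variable {α β : Type*} [MeasurableSpace α] [MeasurableSpace β] {μ : Measure α} {ν : Measure β}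

theorem exists_measurable_leftInverse_of_injOn [StandardBorelSpace α] [Nonempty α]
    [MeasurableSpace.CountablySeparated β] {f : α → β} (hf : Measurable f) {t : Set α}
    (ht : MeasurableSet t) (hinj : Set.InjOn f t) :
    ∃ g : β → α, Measurable g ∧ Set.LeftInvOn g f t := by
  have := ht.standardBorel
  obtain ⟨g, hg, hgf⟩ := ((hf.comp measurable_subtype_coe).measurableEmbedding
    hinj.injective).exists_measurable_extend measurable_subtype_coe fun _ => inferInstance
  exact ⟨g, hg, fun x hx => congrFun hgf ⟨x, hx⟩⟩

namespace NullMeasurePreserving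

theorem measurePreserving [μ.IsComplete] {f : α → β} (hf : NullMeasurePreserving f μ ν) :
    MeasurePreserving f μ ν := by
  have hm : Measurable f := hf.nullMeasurable.measurable_of_complete
  refine ⟨hm, Measure.ext fun s hs => ?_⟩
  rw [Measure.map_apply hm hs, hf.measure_preimage s hs]

theorem of_measurePreserving_completion {f : α → β}
    (h : MeasurePreserving (β := NullMeasurableSpace β ν) f μ ν.completion) :
    NullMeasurePreserving f μ ν where
  nullMeasurable _ hs := (h.measurable hs.nullMeasurableSet).nullMeasurableSet
  measure_preimage s hs := by
    have hs' : MeasurableSet (α := NullMeasurableSpace β ν) s := hs.nullMeasurableSet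
    exact h.measure_preimage hs'.nullMeasurableSet

theorem ae_eq_id [MeasurableSpace.CountablyGenerated β] [MeasurableEq β] {f : α → β}
    (hf : NullMeasurePreserving f μ ν) {r : β → β} (hr : NullMeasurePreserving r ν ν)
    (h : ∀ᵐ x ∂μ, r (f x) = f x) : ∀ᵐ y ∂ν, r y = y := by
  obtain ⟨q, hq, hrq⟩ := hr.exists_measurePreserving
  have hqf : ∀ᵐ x ∂μ, q (f x) = f x := by
    filter_upwards [h, hf.ae hrq] with x h₁ h₂ using h₂.symm.trans h₁
  have hfix : MeasurableSet {y | q y = y} := measurableSet_eq_fun hq.measurable measurable_id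
  have hqid : ∀ᵐ y ∂ν, q y = y := (hf.measure_preimage _ hfix.compl).symm.trans hqf
  filter_upwards [hqid, hrq] with y h₁ h₂ using h₂.trans h₁

theorem exists_ae_leftInverse [StandardBorelSpace α] [Nonempty α]
    [MeasurableSpace.CountablyGenerated β] [MeasurableSpace.CountablySeparated β] {f : α → β}
    (hf : NullMeasurePreserving f μ ν) {s : Set α} (hs : ∀ᵐ x ∂μ, x ∈ s) (hinj : Set.InjOn f s) :
    ∃ g : β → α, NullMeasurePreserving g ν μ ∧ ∀ᵐ x ∂μ, g (f x) = x := by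
  obtain ⟨k, hk, hfk⟩ := hf.exists_measurePreserving
  obtain ⟨t, ht, htm, hts⟩ := (hs.and hfk).exists_measurable_mem
  have hkinj : Set.InjOn k t := fun x hx y hy hxy => by
    obtain ⟨hxs, hx⟩ := hts x hx
    obtain ⟨hys, hy⟩ := hts y hy
    exact hinj hxs hys (hx.trans (hxy.trans hy.symm))
  obtain ⟨g, hg, hgk⟩ := exists_measurable_leftInverse_of_injOn hk.measurable htm hkinj
  have hgf : ∀ᵐ x ∂μ, g (f x) = x := by
    filter_upwards [ht] with x hx
    rw [(hts x hx).2, hgk hx]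
  exact ⟨g, hf.of_ae_leftInverse hg.nullMeasurable hgf, hgf⟩

end NullMeasurePreserving

end Inverses

section IsoModZero

variable {α β : Type*} [MeasurableSpace α] [MeasurableSpace β] {μ : Measure α} {ν : Measure β}

theorem measurePreserving_comap_subtype {φ : α → β} (hφ : MeasurePreserving φ μ ν) {s : Set α}
    {t : Set β} (hs : MeasurableSet s) (ht : MeasurableSet t) (hμ : ∀ᵐ x ∂μ, x ∈ s)
    {e : s → t} (he : Measurable e) (heφ : ∀ x, (e x : β) = φ x) :
    MeasurePreserving e (μ.comap Subtype.val) (ν.comap Subtype.val) := by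
  have hval : ((μ.comap Subtype.val).map e).map Subtype.val = (ν : Measure β) :=
    calc ((μ.comap Subtype.val).map e).map Subtype.val
        = (μ.comap Subtype.val).map (φ ∘ Subtype.val) := by
          rw [Measure.map_map measurable_subtype_coe he]
          exact congrArg (Measure.map · _) (funext heφ)
      _ = (μ.restrict s).map φ := by
          rw [← Measure.map_map hφ.measurable measurable_subtype_coe, map_comap_subtype_coe hs]
      _ = ν := by rw [Measure.restrict_eq_self_of_ae_mem hμ, hφ.map_eq]
  refine ⟨he, ?_⟩
  rw [← hval, (MeasurableEmbedding.subtype_coe ht).comap_map]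

theorem exists_measurableEquiv_compl_of_ae_inverse {φ : α → β} {ψ : β → α}
    (hφ : MeasurePreserving φ μ ν) (hψ : MeasurePreserving ψ ν μ)
    (hψφ : ∀ᵐ x ∂μ, ψ (φ x) = x) (hφψ : ∀ᵐ y ∂ν, φ (ψ y) = y) :
    ∃ (N : Set α) (N' : Set β), MeasurableSet N ∧ μ N = 0 ∧ MeasurableSet N' ∧ ν N' = 0 ∧
      ∃ e : ↥(Nᶜ) ≃ᵐ ↥(N'ᶜ), ∀ x, (e x : β) = φ x := by
  obtain ⟨s, hs, hsm, hψφ⟩ := hψφ.exists_measurable_mem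
  obtain ⟨t, ht, htm, hφψ⟩ := hφψ.exists_measurable_mem
  have hφt : ∀ x ∈ s ∩ φ ⁻¹' t, φ x ∈ t ∩ ψ ⁻¹' s := fun x hx =>
    ⟨hx.2, Set.mem_preimage.2 ((hψφ x hx.1).symm ▸ hx.1)⟩
  have hψs : ∀ y ∈ t ∩ ψ ⁻¹' s, ψ y ∈ s ∩ φ ⁻¹' t := fun y hy =>
    ⟨hy.2, Set.mem_preimage.2 ((hφψ y hy.1).symm ▸ hy.1)⟩
  let e : ↥(s ∩ φ ⁻¹' t) ≃ᵐ ↥(t ∩ ψ ⁻¹' s) :=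
    { toFun := fun x => ⟨φ x, hφt x x.2⟩
      invFun := fun y => ⟨ψ y, hψs y y.2⟩
      left_inv := fun x => Subtype.ext (hψφ x x.2.1)
      right_inv := fun y => Subtype.ext (hφψ y y.2.1)
      measurable_toFun := (hφ.measurable.comp measurable_subtype_coe).subtype_mk
      measurable_invFun := (hψ.measurable.comp measurable_subtype_coe).subtype_mk }
  refine ⟨(s ∩ φ ⁻¹' t)ᶜ, (t ∩ ψ ⁻¹' s)ᶜ, (hsm.inter (hφ.measurable htm)).compl,
    Filter.inter_mem hs (hφ.quasiMeasurePreserving.ae ht),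
    (htm.inter (hψ.measurable hsm)).compl,
    Filter.inter_mem ht (hψ.quasiMeasurePreserving.ae hs), ?_⟩
  rw [compl_compl, compl_compl]
  exact ⟨e, fun x => rfl⟩

theorem isIsoModZero_of_ae_inverse {φ : α → β} {ψ : β → α} (hφ : MeasurePreserving φ μ ν)
    (hψ : MeasurePreserving ψ ν μ) (hψφ : ∀ᵐ x ∂μ, ψ (φ x) = x) (hφψ : ∀ᵐ y ∂ν, φ (ψ y) = y) :
    IsIsoModZero φ μ ν := by
  obtain ⟨N, N', hN, hN0, hN', hN'0, e, he⟩ :=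
    exists_measurableEquiv_compl_of_ae_inverse hφ hψ hψφ hφψ
  exact ⟨hφ, N, N', hN, hN0, hN', hN'0, e, he, measurePreserving_comap_subtype hφ hN.compl
    hN'.compl (measure_eq_zero_iff_ae_notMem.1 hN0) e.measurable he⟩

theorem IsIsoModZero.exists_ae_leftInverse [Nonempty α] {φ : α → β} (h : IsIsoModZero φ μ ν) :
    ∃ ψ : β → α, Measurable ψ ∧ (∀ᵐ x ∂μ, ψ (φ x) = x) ∧
      ∃ s : Set β, (∀ᵐ y ∂ν, y ∈ s) ∧ Set.InjOn ψ s := by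
  obtain ⟨-, N, N', -, hN0, hN', hN'0, e, he, -⟩ := h
  obtain ⟨ψ, hψ, hψe⟩ := (MeasurableEmbedding.subtype_coe hN'.compl).exists_measurable_extend
    (measurable_subtype_coe.comp e.symm.measurable) fun _ => inferInstance
  replace hψe : ∀ y : ↥(N'ᶜ), ψ y = e.symm y := congrFun hψe
  refine ⟨ψ, hψ, ?_, N'ᶜ, measure_eq_zero_iff_ae_notMem.1 hN'0, fun y hy z hz hyz => ?_⟩
  · filter_upwards [measure_eq_zero_iff_ae_notMem.1 hN0] with x hx
    rw [← he ⟨x, hx⟩, hψe, e.symm_apply_apply]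
  · rw [hψe ⟨y, hy⟩, hψe ⟨z, hz⟩] at hyz
    exact congrArg Subtype.val (e.symm.injective (Subtype.ext hyz))

theorem IsIsoModZero.exists_nullMeasurePreserving_ae_leftInverse [Nonempty α]
    {φ : α → NullMeasurableSpace β ν} (h : IsIsoModZero φ μ ν.completion) :
    ∃ (θ : α → β) (ψ : β → α), NullMeasurePreserving θ μ ν ∧ NullMeasurePreserving ψ ν μ ∧
      (∀ᵐ x ∂μ, ψ (θ x) = x) ∧ ∃ s : Set β, (∀ᵐ y ∂ν, y ∈ s) ∧ Set.InjOn ψ s := by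
  obtain ⟨ψ, hψ, hψφ, s, hs, hinj⟩ := h.exists_ae_leftInverse
  have hφ : NullMeasurePreserving (β := β) φ μ ν := .of_measurePreserving_completion h.1
  have hψ' : NullMeasurePreserving (α := β) ψ ν μ := hφ.of_ae_leftInverse (fun _ hs => hψ hs) hψφ
  exact ⟨φ, ψ, hφ, hψ', hψφ, s, hs, hinj⟩

end IsoModZero

section LebesgueSpace

theorem measurableSet_borel_image {α β : Type*} [TopologicalSpace α] [MeasurableSpace α]
    [BorelSpace α] [TopologicalSpace β] {f : α → β} (hf : Topology.IsOpenEmbedding f) {s : Set α}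
    (hs : MeasurableSet s) : MeasurableSet[borel β] (f '' s) := by
  borelize β
  exact hf.measurableEmbedding.measurableSet_image.2 hs

instance instStandardBorelSpaceSum {α β : Type*} [MeasurableSpace α] [StandardBorelSpace α]
    [MeasurableSpace β] [StandardBorelSpace β] : StandardBorelSpace (α ⊕ β) := by
  let := upgradeStandardBorel α
  let := upgradeStandardBorel β
  have : BorelSpace (α ⊕ β) := by
    refine ⟨le_antisymm (fun s hs => ?_) (MeasurableSpace.generateFrom_le fun s hs => ?_)⟩
    · rw [measurableSet_sum_iff] at hs
      rw [← Set.image_preimage_inl_union_image_preimage_inr s]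
      exact (measurableSet_borel_image .inl hs.1).union (measurableSet_borel_image .inr hs.2)
    · have hs' : IsOpen s := hs
      exact measurableSet_sum_iff.2 ⟨(hs'.preimage continuous_inl).measurableSet,
        (hs'.preimage continuous_inr).measurableSet⟩
  infer_instance

variable {Ω : Type*} [MeasurableSpace Ω] {π : Measure Ω} [IsProbabilityMeasure π]

theorem IsLebesgueSpace.exists_ae_leftInverse (h : IsLebesgueSpace π) {K : Type*}
    [MeasurableSpace K] [MeasurableSpace.CountablyGenerated K]
    [MeasurableSpace.CountablySeparated K] {ρ : Measure K} {f : Ω → K}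
    (hf : NullMeasurePreserving f π ρ) {s : Set Ω} (hs : ∀ᵐ x ∂π, x ∈ s)
    (hinj : Set.InjOn f s) :
    ∃ g : K → Ω, NullMeasurePreserving g ρ π ∧ ∀ᵐ x ∂π, g (f x) = x := by
  obtain ⟨-, a, b, A, p, -, -, φ, hφ⟩ := h
  have hΩ := nonempty_of_isProbabilityMeasure π
  obtain ⟨θ, ψ, hθ, hψ, hψθ, t, ht, hψinj⟩ := hφ.exists_nullMeasurePreserving_ae_leftInverse
  have := hΩ.map θ
  obtain ⟨g, hg, hgf⟩ := (hf.comp hψ).exists_ae_leftInverse (s := t ∩ ψ ⁻¹' s)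
    (Filter.inter_mem ht (hψ.ae hs)) fun x hx y hy hxy => hψinj hx.1 hy.1 (hinj hx.2 hy.2 hxy)
  refine ⟨ψ ∘ g, hψ.comp hg, ?_⟩
  filter_upwards [hψθ, hθ.ae hgf] with x h₁ h₂
  rw [Function.comp_apply, h₁] at h₂
  rw [Function.comp_apply, h₂, h₁]

end LebesgueSpace

namespace Graphon

variable {Ω Ω' : Type*} [MeasurableSpace Ω] [MeasurableSpace Ω']
  {π : Measure Ω} [IsProbabilityMeasure π] {π' : Measure Ω'} [IsProbabilityMeasure π']

theorem IsWeakIso.twins_of_apply_eq {H : Graphon Ω π} {G : Graphon Ω' π'} {φ : Ω → Ω'}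
    (h : H.IsWeakIso G φ) :
    ∃ s : Set Ω, (∀ᵐ x ∂π, x ∈ s) ∧ ∀ x ∈ s, ∀ y ∈ s, φ x = φ y → H.Twins x y := by
  refine ⟨{x | ∀ᵐ y ∂π, H.W x y = G.W (φ x) (φ y)}, Measure.ae_ae_of_ae_prod h.2,
    fun x hx y hy hxy => ?_⟩
  filter_upwards [hx, hy] with z h₁ h₂
  rw [h₁, h₂, hxy]

theorem IsWeakIso.exists_injOn {H : Graphon Ω π} {G : Graphon Ω' π'} {φ : Ω → Ω'}
    (h : H.IsWeakIso G φ) (hH : H.AlmostTwinFree) :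
    ∃ s : Set Ω, (∀ᵐ x ∂π, x ∈ s) ∧ Set.InjOn φ s := by
  obtain ⟨N, hN, htw⟩ := hH
  obtain ⟨s, hs, hφ⟩ := h.twins_of_apply_eq
  refine ⟨s ∩ Nᶜ, Filter.inter_mem hs (measure_eq_zero_iff_ae_notMem.1 hN),
    fun x hx y hy hxy => by_contra fun hne => ?_⟩
  exact htw x hx.2 y hy.2 hne (hφ x hx.1 y hy.1 hxy)

theorem IsWeakIso.exists_ae_inverse (hπ : IsLebesgueSpace π) {H : Graphon Ω π}
    (hH : H.AlmostTwinFree) [StandardBorelSpace Ω'] {G : Graphon Ω' π'} {φ : Ω → Ω'}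
    (h : H.IsWeakIso G φ) :
    ∃ ψ : Ω' → Ω, NullMeasurePreserving ψ π' π ∧ (∀ᵐ x ∂π, ψ (φ x) = x) ∧
      ∀ᵐ y ∂π', φ (ψ y) = y := by
  obtain ⟨s, hs, hinj⟩ := h.exists_injOn hH
  have hφ := (isWeakIso_iff.1 h).1
  obtain ⟨ψ, hψ, hψφ⟩ := hπ.exists_ae_leftInverse hφ hs hinj
  refine ⟨ψ, hψ, hψφ, hφ.ae_eq_id (hφ.comp hψ) ?_⟩
  filter_upwards [hψφ] with x hx using congrArg φ hx

theorem isomorphicModZero_of_density_eq {H : Graphon Ω π} {H' : Graphon Ω' π'}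
    (hπ : IsLebesgueSpace π) (hπ' : IsLebesgueSpace π') (hH : H.AlmostTwinFree)
    (hH' : H'.AlmostTwinFree)
    (hd : ∀ (k : ℕ) (F : SimpleGraph (Fin k)), H.density F = H'.density F) :
    H.IsomorphicModZero H' := by
  obtain ⟨a, b, hab, hHb⟩ := H.exists_forall_mem_Icc
  obtain ⟨ρ, _, G, f, f', -, -, hf, hf'⟩ := exists_isWeakIso_of_density_eq hd hab hHb
  obtain ⟨g, hg, hgf, hfg⟩ := hf.exists_ae_inverse hπ hH
  obtain ⟨g', hg', hgf', hfg'⟩ := hf'.exists_ae_inverse hπ' hH'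
  rw [isWeakIso_iff] at hf hf'
  have := hπ.1
  have := hπ'.1
  have hf'g'f : ∀ᵐ x ∂π, f' (g' (f x)) = f x := hf.1.ae hfg'
  have hfgf' : ∀ᵐ y ∂π', f (g (f' y)) = f' y := hf'.1.ae hfg
  refine ⟨g' ∘ f, isIsoModZero_of_ae_inverse (ψ := g ∘ f')
    (hg'.comp hf.1).measurePreserving (hg.comp hf'.1).measurePreserving ?_ ?_, ?_⟩
  · filter_upwards [hgf, hf'g'f] with x h₁ h₂
    simp only [Function.comp_apply, h₂, h₁]
  · filter_upwards [hgf', hfgf'] with y h₁ h₂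
    simp only [Function.comp_apply, h₂, h₁]
  · have hφ := hg'.comp hf.1
    filter_upwards [hf.2, (hφ.prodMap hφ).ae hf'.2, Measure.quasiMeasurePreserving_fst.ae hf'g'f,
      Measure.quasiMeasurePreserving_snd.ae hf'g'f] with z h₁ h₂ h₃ h₄
    simp only [Prod.map, Function.comp_apply, h₃, h₄] at h₂
    simp only [Function.comp_apply, h₂, h₁]

theorem IsomorphicModZero.density_eq {H : Graphon Ω π} {H' : Graphon Ω' π'}
    (h : H.IsomorphicModZero H') {k : ℕ} (F : SimpleGraph (Fin k)) :
    H.density F = H'.density F := by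
  obtain ⟨φ, hφ, hW⟩ := h
  refine IsWeakIso.density_eq (φ := φ) (isWeakIso_iff.2 ⟨.of_measurePreserving hφ.1, ?_⟩) F
  filter_upwards [hW] with z hz using hz.symm

end Graphon

section UnitInterval

open ProbabilityTheory

theorem continuous_cdf (ν : Measure ℝ) [IsProbabilityMeasure ν] [NullSingletonClass ν] :
    Continuous (cdf ν) := by
  refine continuous_iff_continuousAt.2 fun x => ?_
  have hjump : ENNReal.ofReal (cdf ν x - Function.leftLim (cdf ν) x) = 0 := by
    rw [← StieltjesFunction.measure_singleton, measure_cdf, measure_singleton]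
  rw [(monotone_cdf ν).continuousAt_iff_leftLim_eq_rightLim, StieltjesFunction.rightLim_eq]
  exact ((monotone_cdf ν).leftLim_le le_rfl).antisymm
    (sub_nonpos.1 (ENNReal.ofReal_eq_zero.1 hjump))

theorem exists_cdf_eq (ν : Measure ℝ) [IsProbabilityMeasure ν] [NullSingletonClass ν] {r : ℝ}
    (hr : r ∈ Set.Ioo 0 1) : ∃ x, cdf ν x = r :=
  mem_range_of_exists_le_of_exists_ge (continuous_cdf ν)
    ((tendsto_cdf_atBot ν).eventually (ge_mem_nhds hr.1)).exists
    ((tendsto_cdf_atTop ν).eventually (le_mem_nhds hr.2)).exists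

theorem measureReal_setOf_cdf_le (ν : Measure ℝ) [IsProbabilityMeasure ν] [NullSingletonClass ν]
    {s : ℝ} (hs : s ∈ Set.Icc 0 1) : ν.real {t | cdf ν t ≤ s} = s := by
  refine le_antisymm ?_ ?_
  · refine le_of_forall_gt_imp_ge_of_dense fun r hsr => ?_
    rcases le_or_gt 1 r with hr | hr
    · exact measureReal_le_one.trans hr
    obtain ⟨y, rfl⟩ := exists_cdf_eq ν ⟨hs.1.trans_lt hsr, hr⟩
    rw [cdf_eq_real]
    exact measureReal_mono fun t ht => ((monotone_cdf ν).reflect_lt (ht.trans_lt hsr)).le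
  · refine le_of_forall_lt_imp_le_of_dense fun r hrs => ?_
    rcases le_or_gt r 0 with hr | hr
    · exact hr.trans measureReal_nonneg
    obtain ⟨y, rfl⟩ := exists_cdf_eq ν ⟨hr, hrs.trans_le hs.2⟩
    rw [cdf_eq_real]
    exact measureReal_mono fun t ht => (monotone_cdf ν ht).trans hrs.le

/-- The distribution function of `ν` with values in the unit interval, which carries an atomless
`ν` to Lebesgue measure. -/
noncomputable def unitCDF (ν : Measure ℝ) (t : ℝ) : unitInterval :=
  ⟨cdf ν t, cdf_nonneg ν t, cdf_le_one ν t⟩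

theorem monotone_unitCDF (ν : Measure ℝ) : Monotone (unitCDF ν) :=
  fun _ _ h => monotone_cdf ν h

theorem measurePreserving_unitCDF (ν : Measure ℝ) [IsProbabilityMeasure ν] [NullSingletonClass ν] :
    MeasurePreserving (unitCDF ν) ν volume := by
  have hm : Measurable (unitCDF ν) := (monotone_unitCDF ν).measurable
  have := Measure.isProbabilityMeasure_map (μ := ν) hm.aemeasurable
  refine ⟨hm, Measure.ext_of_Iic _ _ fun s => ?_⟩
  rw [Measure.map_apply hm measurableSet_Iic, unitInterval.volume_Iic,
    ← measureReal_setOf_cdf_le ν s.2, ofReal_measureReal]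
  rfl

theorem exists_measurePreserving_unitInterval {α : Type*} [MeasurableSpace α]
    [StandardBorelSpace α] (ν : Measure α) [IsProbabilityMeasure ν] [NullSingletonClass ν] :
    ∃ (F : α → unitInterval) (Q : unitInterval → α), MeasurePreserving F ν volume ∧
      Measurable Q ∧ ∀ᵐ x ∂ν, Q (F x) = x := by
  obtain ⟨e, he⟩ := exists_measurableEmbedding_real α
  have := nonempty_of_isProbabilityMeasure ν
  have := Measure.isProbabilityMeasure_map (μ := ν) he.measurable.aemeasurable
  have : NullSingletonClass (ν.map e) := ⟨fun t => by
    rw [he.map_apply]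
    exact (Set.subsingleton_singleton.preimage he.injective).measure_zero ν⟩
  have hF : MeasurePreserving (unitCDF (ν.map e) ∘ e) ν volume :=
    (measurePreserving_unitCDF (ν.map e)).comp ⟨he.measurable, rfl⟩
  set B := {c | ∃ x y, x < y ∧ unitCDF (ν.map e) x = c ∧ unitCDF (ν.map e) y = c}
  have hB : B.Countable := (monotone_unitCDF (ν.map e)).countable_setOfPred_two_preimages
  have hinj : Set.InjOn (unitCDF (ν.map e) ∘ e) ((unitCDF (ν.map e) ∘ e) ⁻¹' Bᶜ) :=
    fun x hx y hy hxy => he.injective <| le_antisymm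
      (not_lt.1 fun hlt => hx ⟨e y, e x, hlt, hxy.symm, rfl⟩)
      (not_lt.1 fun hlt => hy ⟨e x, e y, hlt, hxy, rfl⟩)
  obtain ⟨Q, hQ, hQF⟩ := exists_measurable_leftInverse_of_injOn hF.measurable
    (hF.measurable hB.measurableSet.compl) hinj
  refine ⟨_, Q, hF, hQ, ?_⟩
  filter_upwards [hF.quasiMeasurePreserving.ae (measure_eq_zero_iff_ae_notMem.1
    (hB.measure_zero volume))] with x hx using hQF hx

theorem exists_measurable_map_eq_smul_volume {α : Type*} [MeasurableSpace α]
    [StandardBorelSpace α] (μ : Measure α) [IsFiniteMeasure μ] [NullSingletonClass μ] :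
    ∃ F : α → unitInterval, Measurable F ∧ μ.map F = μ Set.univ • volume := by
  rcases eq_zero_or_neZero μ with rfl | hμ
  · exact ⟨fun _ => 0, measurable_const, by simp⟩
  have : NullSingletonClass ((μ Set.univ)⁻¹ • μ) := ⟨fun x => by simp⟩
  obtain ⟨F, -, hF, -⟩ := exists_measurePreserving_unitInterval ((μ Set.univ)⁻¹ • μ)
  refine ⟨F, hF.measurable, ?_⟩
  rw [← hF.map_eq, Measure.map_smul, smul_smul,
    ENNReal.mul_inv_cancel (NeZero.ne _) (measure_ne_top μ _), one_smul]

end UnitInterval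

section SpreadAtoms

variable {K : Type*} [MeasurableSpace K]

/-- The measure on `K × [0, 1]` which spreads each atom `k` of `ρ` uniformly over `{k} × [0, 1]`
and puts the atomless part of `ρ` on `K × {0}`. -/
noncomputable def spreadAtoms (ρ : Measure K) : Measure (K × unitInterval) :=
  (ρ.restrict {k | ρ {k} ≠ 0}ᶜ).prod (Measure.dirac 0) + (ρ.restrict {k | ρ {k} ≠ 0}).prod volume

variable (ρ : Measure K)

theorem countable_setOf_measure_singleton_ne_zero [MeasurableSingletonClass K] [SFinite ρ] :
    {k | ρ {k} ≠ 0}.Countable :=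
  (Measure.countable_meas_level_set_pos (μ := ρ) measurable_id).mono fun _ => pos_iff_ne_zero.2

instance [MeasurableSingletonClass K] [IsProbabilityMeasure ρ] :
    IsProbabilityMeasure (spreadAtoms ρ) where
  measure_univ := by
    rw [spreadAtoms, Measure.add_apply, ← Set.univ_prod_univ, Measure.prod_prod, Measure.prod_prod]
    simp only [measure_univ, mul_one, ← Measure.add_apply]
    rw [add_comm, Measure.restrict_add_restrict_compl
      (countable_setOf_measure_singleton_ne_zero ρ).measurableSet, measure_univ]

instance [MeasurableSingletonClass K] : NullSingletonClass (spreadAtoms ρ) where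
  measure_singleton z := by
    have : NullSingletonClass (ρ.restrict {k | ρ {k} ≠ 0}ᶜ) := ⟨fun k => by
      by_cases hk : ρ {k} = 0 <;> simp [hk]⟩
    rw [spreadAtoms, Measure.add_apply, measure_singleton, measure_singleton, add_zero]

variable {ρ} {α : Type*} [MeasurableSpace α] {ν : Measure α} {f : α → K}

theorem exists_measurable_eqOn_fibers [MeasurableSingletonClass K] {β : Type*} [MeasurableSpace β]
    {A : Set K} (hA : A.Countable) (hf : Measurable f) (b : β) {F : A → α → β}
    (hF : ∀ k, Measurable (F k)) :
    ∃ θ : α → β, Measurable θ ∧ Set.EqOn θ (fun _ => b) (f ⁻¹' Aᶜ) ∧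
      ∀ k : A, Set.EqOn θ (F k) (f ⁻¹' {(k : K)}) := by
  have := hA.to_subtype
  let t : Option A → Set α := fun i => i.elim (f ⁻¹' Aᶜ) fun k => f ⁻¹' {(k : K)}
  have ht : ∀ i, MeasurableSet (t i) :=
    Option.rec (hf hA.measurableSet.compl) fun _ => hf (measurableSet_singleton _)
  let g : Option A → α → β := fun i => i.elim (fun _ => b) F
  have hg : ∀ i, Measurable (g i) := Option.rec measurable_const hF
  obtain ⟨θ, hθ, hθg⟩ := exists_measurable_piecewise t ht g hg fun i j hij x hx => by
    rcases i with _ | i <;> rcases j with _ | j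
    · rfl
    · exact absurd (hx.2 ▸ j.2 : f x ∈ A) hx.1
    · exact absurd (hx.1 ▸ i.2 : f x ∈ A) hx.2
    · exact absurd (congrArg some (Subtype.ext (hx.1.symm.trans hx.2))) hij
  exact ⟨θ, hθ, hθg none, fun k => hθg (some k)⟩

theorem restrict_preimage_eq_sum_restrict_fibers [MeasurableSingletonClass K] {A : Set K}
    (hA : A.Countable) (hf : Measurable f) :
    ν.restrict (f ⁻¹' A) = Measure.sum fun k : A => ν.restrict (f ⁻¹' {(k : K)}) := by
  have := hA.to_subtype
  conv_lhs => rw [← Set.iUnion_of_singleton_coe A, Set.preimage_iUnion]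
  exact Measure.restrict_iUnion
    (fun i j hij => (Set.disjoint_singleton.2 (Subtype.coe_ne_coe.2 hij)).preimage f)
    fun _ => hf (measurableSet_singleton _)

theorem map_prodMk_restrict_preimage_of_eqOn_const {β : Type*} [MeasurableSpace β]
    [SFinite ρ] (hf : MeasurePreserving f ν ρ) {s : Set K} (hs : MeasurableSet s) {θ : α → β}
    {b : β} (hθ : Set.EqOn θ (fun _ => b) (f ⁻¹' s)) :
    (ν.restrict (f ⁻¹' s)).map (fun x => (f x, θ x)) = (ρ.restrict s).prod (Measure.dirac b) := by
  rw [Measure.prod_dirac, ← hf.map_eq, Measure.restrict_map hf.measurable hs,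
    Measure.map_map measurable_prodMk_right hf.measurable]
  exact Measure.map_congr (ae_restrict_of_forall_mem (hf.measurable hs) fun x hx =>
    congrArg (Prod.mk (f x)) (hθ hx))

theorem map_prodMk_restrict_fiber [MeasurableSingletonClass K] {β : Type*} [MeasurableSpace β]
    {τ : Measure β} [SFinite τ] (hf : MeasurePreserving f ν ρ) {k : K} {θ F : α → β}
    (hF : Measurable F)
    (hFτ : (ν.restrict (f ⁻¹' {k})).map F = ν (f ⁻¹' {k}) • τ) (hθ : Set.EqOn θ F (f ⁻¹' {k})) :
    (ν.restrict (f ⁻¹' {k})).map (fun x => (f x, θ x)) = (ρ.restrict {k}).prod τ := by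
  have hk := measurableSet_singleton k
  calc (ν.restrict (f ⁻¹' {k})).map (fun x => (f x, θ x))
      = (ν.restrict (f ⁻¹' {k})).map (Prod.mk k ∘ F) :=
        Measure.map_congr (ae_restrict_of_forall_mem (hf.measurable hk) fun x hx =>
          Prod.ext hx (hθ hx))
    _ = ρ {k} • τ.map (Prod.mk k) := by
        rw [← Measure.map_map measurable_prodMk_left hF, hFτ,
          hf.measure_preimage hk.nullMeasurableSet, Measure.map_smul]
    _ = (ρ.restrict {k}).prod τ := by
        rw [Measure.restrict_singleton, Measure.prod_smul_left, Measure.dirac_prod]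

theorem exists_measurePreserving_spreadAtoms [StandardBorelSpace K] [IsProbabilityMeasure ρ]
    [StandardBorelSpace α] [NullSingletonClass ν] (hf : MeasurePreserving f ν ρ) :
    ∃ θ : α → unitInterval, MeasurePreserving (fun x => (f x, θ x)) ν (spreadAtoms ρ) := by
  have : IsProbabilityMeasure (ν.map f) := by rwa [hf.map_eq]
  have := Measure.isProbabilityMeasure_of_map (μ := ν) f
  set A := {k | ρ {k} ≠ 0}
  have hA : A.Countable := countable_setOf_measure_singleton_ne_zero ρ
  have := hA.to_subtype
  choose F hFm hF using fun k : A =>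
    exists_measurable_map_eq_smul_volume (ν.restrict (f ⁻¹' {(k : K)}))
  simp only [Measure.restrict_apply_univ] at hF
  obtain ⟨θ, hθ, hθ₀, hθF⟩ := exists_measurable_eqOn_fibers hA hf.measurable 0 hFm
  have hfθ : Measurable fun x => (f x, θ x) := hf.measurable.prodMk hθ
  have hatoms : (ν.restrict (f ⁻¹' A)).map (fun x => (f x, θ x)) = (ρ.restrict A).prod volume := by
    have hρA := restrict_preimage_eq_sum_restrict_fibers (ν := ρ) hA measurable_id
    simp only [Set.preimage_id] at hρA
    rw [restrict_preimage_eq_sum_restrict_fibers hA hf.measurable, hρA,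
      Measure.map_sum hfθ.aemeasurable, Measure.prod_sum_left]
    exact congrArg Measure.sum (funext fun k => map_prodMk_restrict_fiber hf (hFm k) (hF k) (hθF k))
  refine ⟨θ, hfθ, ?_⟩
  rw [spreadAtoms, ← hatoms,
    ← map_prodMk_restrict_preimage_of_eqOn_const hf hA.measurableSet.compl hθ₀,
    ← Measure.map_add _ _ hfθ, Set.preimage_compl, add_comm,
    Measure.restrict_add_restrict_compl (hf.measurable hA.measurableSet)]

theorem exists_measurable_factor_unitInterval [StandardBorelSpace K] (ρ : Measure K)
    [IsProbabilityMeasure ρ] :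
    ∃ Q : unitInterval → K, Measurable Q ∧
      ∀ {α : Type v} [MeasurableSpace α] [StandardBorelSpace α] {ν : Measure α}
        [NullSingletonClass ν] {f : α → K}, NullMeasurePreserving f ν ρ →
        ∃ φ : α → unitInterval, MeasurePreserving φ ν volume ∧ ∀ᵐ x ∂ν, Q (φ x) = f x := by
  obtain ⟨F, Q, hF, hQ, hQF⟩ := exists_measurePreserving_unitInterval (spreadAtoms ρ)
  refine ⟨fun s => (Q s).1, hQ.fst, fun {α} _ _ ν _ f hf => ?_⟩
  obtain ⟨g, hg, hfg⟩ := hf.exists_measurePreserving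
  obtain ⟨θ, hθ⟩ := exists_measurePreserving_spreadAtoms hg
  refine ⟨fun x => F (g x, θ x), hF.comp hθ, ?_⟩
  filter_upwards [hθ.quasiMeasurePreserving.ae hQF, hfg] with x hx hx'
  rw [hx, hx']

end SpreadAtoms

namespace Graphon

theorem IsStrong.exists_unitInterval_pullback {K : Type*} [MeasurableSpace K]
    [StandardBorelSpace K] {ρ : Measure K} [IsProbabilityMeasure ρ] {G : Graphon K ρ}
    (hG : G.IsStrong) :
    ∃ (U : Graphon unitInterval volume) (Q : unitInterval → K),
      (∀ x y, U.W x y = G.W (Q x) (Q y)) ∧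
      ∀ {Ω : Type v} [MeasurableSpace Ω] [StandardBorelSpace Ω] {π : Measure Ω}
        [IsProbabilityMeasure π] [NullSingletonClass π] {H : Graphon Ω π} {f : Ω → K},
        H.IsWeakIso G f → ∃ φ, H.IsWeakIso U φ := by
  obtain ⟨Q, hQ, hQf⟩ := exists_measurable_factor_unitInterval.{v} ρ
  have hU : Measurable fun z : unitInterval × unitInterval => G.W (Q z.1) (Q z.2) :=
    hG.comp (hQ.prodMap hQ)
  refine ⟨⟨fun x y => G.W (Q x) (Q y), fun _ _ => G.symm _ _,
    G.bounded.imp fun _ hC _ _ => hC _ _, hU.nullMeasurable⟩, Q, fun _ _ => rfl,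
    fun {Ω} _ _ π _ _ H f h => ?_⟩
  rw [isWeakIso_iff] at h
  obtain ⟨φ, hφ, hQφ⟩ := hQf h.1
  refine ⟨φ, isWeakIso_iff.2 ⟨.of_measurePreserving hφ, ?_⟩⟩
  filter_upwards [h.2, Measure.quasiMeasurePreserving_fst.ae hQφ,
    Measure.quasiMeasurePreserving_snd.ae hQφ] with z h₁ h₂ h₃
  rw [h₁, h₂, h₃]

end Graphon

theorem theorem1 :
    -- (i) almost twin-free graphons on Lebesgue spaces
    (∀ (Ω : Type u) (Ω' : Type v) [MeasurableSpace Ω] [MeasurableSpace Ω']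
      (π : Measure Ω) [IsProbabilityMeasure π] (π' : Measure Ω') [IsProbabilityMeasure π']
      (H : Graphon Ω π) (H' : Graphon Ω' π'),
      IsLebesgueSpace π → IsLebesgueSpace π' → H.AlmostTwinFree → H'.AlmostTwinFree →
      ((∀ (k : ℕ) (F : SimpleGraph (Fin k)), H.density F = H'.density F) ↔
        H.IsomorphicModZero H')) ∧
    -- (ii) arbitrary graphons
    (∀ (Ω : Type u) (Ω' : Type v) [MeasurableSpace Ω] [MeasurableSpace Ω']
      (π : Measure Ω) [IsProbabilityMeasure π] (π' : Measure Ω') [IsProbabilityMeasure π']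
      (H : Graphon Ω π) (H' : Graphon Ω' π'),
      (∀ (k : ℕ) (F : SimpleGraph (Fin k)), H.density F = H'.density F) ↔
        Graphon.WeaklyIsomorphic.{u, v, w} H H') ∧
    -- uniqueness of the limit of a convergent graph sequence up to measure-preserving maps
    (∀ (m : ℕ → ℕ) (G : ∀ n, SimpleGraph (Fin (m n))), (∀ n, 0 < m n) →
      ∀ H H' : Graphon unitInterval volume, H.UnitValued → H'.UnitValued → H.IsLimitOf G →
      (H'.IsLimitOf G ↔
        ∃ (U : Graphon unitInterval volume) (φ ψ : unitInterval → unitInterval),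
          U.UnitValued ∧ H.IsWeakIso U φ ∧ H'.IsWeakIso U ψ)) := by
  refine ⟨?_, ?_, ?_⟩
  · intro Ω Ω' _ _ π _ π' _ H H' hπ hπ' hH hH'
    exact ⟨Graphon.isomorphicModZero_of_density_eq hπ hπ' hH hH', fun h _ F => h.density_eq F⟩
  · intro Ω Ω' _ _ π _ π' _ H H'
    exact ⟨Graphon.weaklyIsomorphic_of_density_eq,
      fun h _ F => Graphon.density_eq_of_weaklyIsomorphic h F⟩
  · intro m G _ H H' hH _ hlim
    constructor
    · intro hlim'
      obtain ⟨ρ, _, G₀, f, f', hG₀, hu, h1, h2⟩ := Graphon.exists_isWeakIso_of_density_eq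
        (fun k F => tendsto_nhds_unique (hlim k F) (hlim' k F)) zero_le_one hH
      obtain ⟨U, Q, hUQ, hlift⟩ := hG₀.exists_unitInterval_pullback
      obtain ⟨φ, hφ⟩ := hlift h1
      obtain ⟨ψ, hψ⟩ := hlift h2
      exact ⟨U, φ, ψ, fun x y => hUQ x y ▸ hu _ _, hφ, hψ⟩
    · rintro ⟨U, φ, ψ, -, h1, h2⟩ k F
      rw [h2.density_eq, ← h1.density_eq]
      exact hlim k F
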